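/- Consider the standard asynchronous shared-memory model: $n$ processes communicate by atomic reads and writes of shared multi-writer multi-reader registers of unbounded size. Each process is a deterministic state machine whose local state persists between its operations. An execution is a finite or infinite sequence of steps from the initial configuration, each step being an invocation $\mathrm{Propose}(v)$ on an idle process (with $v$ from a fixed input domain $D$), a read or write of one register, a local computation, or a response in $D$ by an active process (one whose latest operation has not yet responded). An algorithm is anonymous if all processes run the same program from the same initial local state and have no identifiers. For an execution $\alpha$ and $t\ge 1$, let $\mathrm{In}_t(\alpha)$ be the set of arguments of the $t$-th invocations of $\mathrm{Propose}$ by the processes, and $\mathrm{Out}_t(\alpha)$ the set of responses of their $t$-th $\mathrm{Propose}$ operations. An algorithm solves $m$-obstruction-free repeated $k$-set agreement among $n$ processes if - (validity) $\mathrm{Out}_t(\alpha)\subseteq \mathrm{In}_t(\alpha)$ for every execution $\alpha$ and every $t$; - ($k$-agreement) $|\mathrm{Out}_t(\alpha)|\le k$ for every execution $\alpha$ and every $t$; - ($m$-obstruction-freedom) in every infinite execution in which at most $m$ processes take infinitely many steps, every process that takes infinitely many steps or is idle from some point on completes each of its operations. Theorem. For every input domain $D$ and all integers $1\le m\le k<n$,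 there is an anonymous algorithm that solves $m$-obstruction-free repeated $k$-set agreement among $n$ processes using $(m+1)(n-k)+m^2+1$ registers. -/

import Mathlib

universe u

namespace SharedMemory

/-- The next step prescribed for an active process by its local state, where `Loc` is the type of
local states, `Val` the type of register contents, `r` the number of registers and `D` the domain
of inputs and outputs: an atomic read or an atomic write of one shared register, a local
computation, or the response of the current operation. Every step also yields the new local
state. -/
inductive Action (D Loc Val : Type u) (r : ℕ) : Type u
  | read (j : Fin r) (next : Val → Loc)
  | write (j : Fin r) (x : Val) (next : Loc)
  | internal (next : Loc)
  | respond (d : D) (next : Loc)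

/-- A deterministic anonymous algorithm that implements an operation `Propose(v)`, `v : D`, from
`r` multi-writer multi-reader registers of unbounded size. There is one program and one initial
local state for all processes, and no process identifier occurs in them. The local state persists
from one operation of a process to the next. -/
structure AnonymousAlgorithm (D : Type u) (r : ℕ) where
  /-- local states of a process -/
  Loc : Type u
  /-- values that a register can hold -/
  Val : Type u
  /-- the initial local state of every process -/
  initLoc : Loc
  /-- the initial contents of the registers -/
  initReg : Fin r → Val
  /-- effect of the invocation of `Propose(v)` on the local state -/
  onInvoke : Loc → D → Loc
  /-- the unique next step of an active process in a given local state -/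
  action : Loc → Action D Loc Val r

variable {D : Type u} {r n : ℕ}

/-- A configuration of a system of `n` processes. -/
structure Config (A : AnonymousAlgorithm D r) (n : ℕ) where
  /-- contents of the registers -/
  reg : Fin r → A.Val
  /-- local states of the processes -/
  loc : Fin n → A.Loc
  /-- whether a process is active (`true`) or idle (`false`) -/
  active : Fin n → Bool

/-- The initial configuration: all processes are idle. -/
def Config.init (A : AnonymousAlgorithm D r) (n : ℕ) : Config A n where
  reg := A.initReg
  loc := fun _ => A.initLoc
  active := fun _ => false

/-- The label of a step in an execution: an invocation of `Propose(v)` on process `p`, a register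
access or a local computation by `p`, or a response of `p` with output `d`. -/
inductive Event (D : Type u) (n : ℕ) : Type u
  | invoke (p : Fin n) (v : D)
  | compute (p : Fin n)
  | respond (p : Fin n) (d : D)

/-- The process that performs a step. -/
def Event.owner : Event D n → Fin n
  | .invoke p _ => p
  | .compute p => p
  | .respond p _ => p

/-- `Step C e C'`: the step `e` is possible in `C` and leads to `C'`. Invocations happen only at
idle processes (with an arbitrary input); an active process follows its program. -/
inductive Step {A : AnonymousAlgorithm D r} : Config A n → Event D n → Config A n → Prop
  | invoke (C : Config A n) (p : Fin n) (v : D) (hp : C.active p = false) :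
      Step C (.invoke p v)
        { reg := C.reg
          loc := Function.update C.loc p (A.onInvoke (C.loc p) v)
          active := Function.update C.active p true }
  | read (C : Config A n) (p : Fin n) (j : Fin r) (next : A.Val → A.Loc)
      (hp : C.active p = true) (ha : A.action (C.loc p) = .read j next) :
      Step C (.compute p)
        { reg := C.reg
          loc := Function.update C.loc p (next (C.reg j))
          active := C.active }
  | write (C : Config A n) (p : Fin n) (j : Fin r) (x : A.Val) (next : A.Loc)
      (hp : C.active p = true) (ha : A.action (C.loc p) = .write j x next) :
      Step C (.compute p)
        { reg := Function.update C.reg j x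
          loc := Function.update C.loc p next
          active := C.active }
  | internal (C : Config A n) (p : Fin n) (next : A.Loc)
      (hp : C.active p = true) (ha : A.action (C.loc p) = .internal next) :
      Step C (.compute p)
        { reg := C.reg
          loc := Function.update C.loc p next
          active := C.active }
  | respond (C : Config A n) (p : Fin n) (d : D) (next : A.Loc)
      (hp : C.active p = true) (ha : A.action (C.loc p) = .respond d next) :
      Step C (.respond p d)
        { reg := C.reg
          loc := Function.update C.loc p next
          active := Function.update C.active p false }

/-- An execution of `A` by `n` processes: a finite or infinite sequence of `len` steps from the
initial configuration. Only the events `event i` with `i < len` and the configurations `conf i`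
with `i ≤ len` belong to the execution. -/
structure Execution (A : AnonymousAlgorithm D r) (n : ℕ) where
  len : ℕ∞
  conf : ℕ → Config A n
  event : ℕ → Event D n
  conf_zero : conf 0 = Config.init A n
  step : ∀ i : ℕ, (i : ℕ∞) < len → Step (conf i) (event i) (conf (i + 1))

namespace Execution

variable {A : AnonymousAlgorithm D r}

/-- `α.Occurs i e`: the step number `i` of the execution exists and is `e`. -/
def Occurs (α : Execution A n) (i : ℕ) (e : Event D n) : Prop :=
  (i : ℕ∞) < α.len ∧ α.event i = e

/-- The number of invocations on process `p` among the steps `0, …, i`. -/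
noncomputable def invocations (α : Execution A n) (p : Fin n) (i : ℕ) : ℕ :=
  {j : ℕ | j ≤ i ∧ ∃ v, α.Occurs j (.invoke p v)}.ncard

/-- `In_t(α)`: the arguments of the `t`-th invocations of `Propose` (`t = 1, 2, …`). -/
def inputs (α : Execution A n) (t : ℕ) : Set D :=
  {v | ∃ p i, α.Occurs i (.invoke p v) ∧ α.invocations p i = t}

/-- `Out_t(α)`: the responses of the `t`-th `Propose` operations (`t = 1, 2, …`). A response of `p`
belongs to the latest operation invoked on `p`. -/
def outputs (α : Execution A n) (t : ℕ) : Set D :=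
  {d | ∃ p i, α.Occurs i (.respond p d) ∧ α.invocations p i = t}

/-- Process `p` takes infinitely many steps. -/
def InfinitelyManySteps (α : Execution A n) (p : Fin n) : Prop :=
  {i : ℕ | ∃ e, α.Occurs i e ∧ e.owner = p}.Infinite

/-- Process `p` is correct in an infinite execution: it takes infinitely many steps or is idle from
some point on. -/
def Correct (α : Execution A n) (p : Fin n) : Prop :=
  α.InfinitelyManySteps p ∨ ∃ N : ℕ, ∀ i ≥ N, (α.conf i).active p = false

/-- Process `p` completes each of its operations: each invocation on `p` is followed by a
response of `p`. -/
def CompletesAll (α : Execution A n) (p : Fin n) : Prop :=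
  ∀ i v, α.Occurs i (.invoke p v) → ∃ j > i, ∃ d, α.Occurs j (.respond p d)

end Execution

/-- Validity: in every execution, outputs of the `t`-th operations are inputs of such. -/
def Validity (A : AnonymousAlgorithm D r) (n : ℕ) : Prop :=
  ∀ (α : Execution A n) (t : ℕ), α.outputs t ⊆ α.inputs t

/-- `k`-agreement: in every execution, at most `k` values are output by `t`-th operations. -/
def KAgreement (A : AnonymousAlgorithm D r) (n k : ℕ) : Prop :=
  ∀ (α : Execution A n) (t : ℕ), (α.outputs t).encard ≤ k

/-- `m`-obstruction-freedom: in every infinite execution in which at most `m` processes take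
infinitely many steps, every correct process completes each of its operations. -/
def ObstructionFree (A : AnonymousAlgorithm D r) (n m : ℕ) : Prop :=
  ∀ α : Execution A n, α.len = ⊤ → {p | α.InfinitelyManySteps p}.encard ≤ m →
    ∀ p, α.Correct p → α.CompletesAll p

/-- `A` solves `m`-obstruction-free repeated `k`-set agreement among `n` processes. -/
structure SolvesRepeatedSetAgreement (A : AnonymousAlgorithm D r) (n m k : ℕ) : Prop where
  validity : Validity A n
  agreement : KAgreement A n k
  obstructionFree : ObstructionFree A n m

end SharedMemory

/-! Put `b = n - k + m - 1` and `r = (m + 1) * b`. There are `r + 1` snapshot components and one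
further register. In an operation a process repeatedly writes its preference, tagged with the number
of its completed operations and their outputs, into its next component in cyclic order, and then
scans. If it sees an output of its current operation in some history, it adopts that output.
Otherwise, after a successful scan, it switches to a value held by more than `b` components if there
is one, and it decides if all components belong to its operation and show at most `m` values.

Agreement (`good_of_decisive`, `encard_decided_le`): take the `k - m + 1` earliest deciders of an
operation. The last of them saw a set `V` of at most `m` values. Each of the other `b` processes can
spoil only one component before it scans again. With at most `b` components spoiled, the remaining
`m * b + 1` or more hold values of `V`, so some value of `V` is held more than `b` times and no
other value is. Hence all later decisions lie in `V`, and at most `(k - m) + m` values are decided.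

Progress: if some process completes infinitely many operations, the extra register eventually holds
histories long enough for any slower process to adopt from (`not_stuck_of_unbounded`). Otherwise at
most `m` processes write forever, each in one operation; consider the earliest of these operations.
Call a value live if it is preferred or held by more than `b` components. The set of live values
shrinks and becomes constant. If it has at most `m` elements, some scan becomes decisive. If it has
more, each live value must always have more than `b` copies, pending writes included, or it would
die out. While one process scans, at most `m - 1` writes are pending, and `(m + 1) * (b + 1)` copies
do not fit into `r + 1` components and `m - 1` pending writes (`not_forever_indecisive`).

Scans are anonymous: a process collects until `n * (r + 1) + 2` collects agree. Since each process
counts its writes, a pigeonhole argument shows that the common vector was present at some moment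
(`exists_snapshot`). Agreement can therefore be argued in a run with atomic scans. -/

namespace SharedMemory.SetAgreement

/-! ### The algorithm -/

/-- Contents of a register. A component of the snapshot object holds in `key` the number of
operations completed by the writer together with its preference, in `hist` the outputs of these
operations, and in `ts` the number of earlier writes of the writer. -/
structure Entry (D : Type u) : Type u where
  key : Option (ℕ × D)
  hist : List D
  ts : ℕ

/-- Control state of a process. -/
inductive Phase (D : Type u) : Type u
  | idle
  | update (d : D)
  | scan (d : D) (log : List (Entry D))
  | publish (d : D)
  | done (d : D)

/-- Local state of a process: the component it writes next, the number of its writes so far, the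
outputs of its operations so far, and the control state. -/
structure Local (D : Type u) (r : ℕ) : Type u where
  idx : Fin (r + 1)
  ts : ℕ
  hist : List D
  phase : Phase D

variable {D : Type u} {n m b r : ℕ}

open Classical in
/-- The number of components that hold the preference `d` for operation `t`. -/
noncomputable def count (κ : Fin (r + 1) → Option (ℕ × D)) (t : ℕ) (d : D) : ℕ :=
  (Finset.univ.filter fun j => κ j = some (t, d)).card

open Classical in
/-- The preference after a scan: a value held by more than `b` components, if there is one. -/
noncomputable def newPref (b : ℕ) (κ : Fin (r + 1) → Option (ℕ × D)) (t : ℕ) (d : D) : D :=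
  if b < count κ t d then d
  else if h : ∃ v, b < count κ t v then h.choose else d

open Classical in
/-- A scan that permits a decision: all components belong to operation `t`, and they hold at most
`m` preferences. -/
def Decisive (m : ℕ) (κ : Fin (r + 1) → Option (ℕ × D)) (t : ℕ) : Prop :=
  (∀ j, ∃ d, κ j = some (t, d)) ∧ (Finset.univ.image κ).card ≤ m

/-- The state `l` after finishing the current operation with output `d`. -/
def Local.finish (l : Local D r) (d : D) : Local D r :=
  { l with hist := l.hist ++ [d], phase := .publish d }

open Classical in
/-- The state after a successful scan that returned `κ`. -/
noncomputable def Local.conclude (m b : ℕ) (l : Local D r) (d : D)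
    (κ : Fin (r + 1) → Option (ℕ × D)) : Local D r :=
  if Decisive m κ l.hist.length then l.finish (newPref b κ l.hist.length d)
  else { l with idx := l.idx + 1, phase := .update (newPref b κ l.hist.length d) }

/-- The number of reads between two evaluations of the log. -/
def logSize (n r : ℕ) : ℕ := (n * (r + 1) + 2) * (r + 2)

/-- All collects recorded in the log returned the vector `s` of components. -/
def Uniform (n : ℕ) (log : List (Entry D)) (s : Fin (r + 1) → Entry D) : Prop :=
  ∀ c < n * (r + 1) + 2, ∀ j : Fin (r + 1), log[c * (r + 2) + j]? = some (s j)

/-- An entry of the log has `v` as output of operation `t`. -/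
def Adoptable (log : List (Entry D)) (t : ℕ) (v : D) : Prop :=
  ∃ x ∈ log, x.hist[t]? = some v

open Classical in
/-- The evaluation of a full log. -/
noncomputable def Local.eval (n m b : ℕ) (l : Local D r) (d : D) (log : List (Entry D)) :
    Local D r :=
  if h : ∃ v, Adoptable log l.hist.length v then l.finish h.choose
  else if h : ∃ s : Fin (r + 1) → Entry D, Uniform n log s then
    l.conclude m b d fun j => (h.choose j).key
  else { l with phase := .scan d [] }

/-- The entry that a process writes into a component. -/
def Local.entry (l : Local D r) (d : D) : Entry D := ⟨some (l.hist.length, d), l.hist, l.ts⟩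

/-- The algorithm. Registers `0, …, r` are the components of the snapshot object; the last register
holds the outputs of some process. -/
noncomputable def algorithm (D : Type u) (n m b r : ℕ) : AnonymousAlgorithm D (r + 1 + 1) where
  Loc := Local D r
  Val := Entry D
  initLoc := ⟨0, 0, [], .idle⟩
  initReg := fun _ => ⟨none, [], 0⟩
  onInvoke := fun l v => { l with phase := .update v }
  action := fun l => match l.phase with
    -- An active process is never in this phase, so this clause is a dummy.
    | .idle => .internal l
    | .update d => .write l.idx.castSucc (l.entry d)
        { l with ts := l.ts + 1, phase := .scan d [] }
    | .scan d log =>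
        if log.length < logSize n r then
          -- The index is taken modulo `r + 2`: all registers are read cyclically, and the last one
          -- closes each collect.
          .read (Fin.ofNat (r + 2) log.length) fun x => { l with phase := .scan d (log ++ [x]) }
        else .internal (l.eval n m b d log)
    | .publish d => .write (Fin.last (r + 1)) ⟨none, l.hist, 0⟩ { l with phase := .done d }
    | .done d => .respond d { l with phase := .idle }

/-! ### Executions as infinite sequences of moves -/

/-- The steps of the algorithm (`none` stands for no step). -/
inductive Move (m b : ℕ) (g : Fin (r + 2) → Entry D) (l : Fin n → Local D r) :
    Option (Event D n) → (Fin (r + 2) → Entry D) → (Fin n → Local D r) → Prop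
  | stutter : Move m b g l none g l
  | invoke (p : Fin n) (v : D) (h : (l p).phase = .idle) :
      Move m b g l (some (.invoke p v)) g (Function.update l p { l p with phase := .update v })
  | write (p : Fin n) (d : D) (h : (l p).phase = .update d) :
      Move m b g l (some (.compute p)) (Function.update g (l p).idx.castSucc ((l p).entry d))
        (Function.update l p { l p with ts := (l p).ts + 1, phase := .scan d [] })
  | read (p : Fin n) (d : D) (log : List (Entry D)) (h : (l p).phase = .scan d log)
      (hlt : log.length < logSize n r) :
      Move m b g l (some (.compute p)) g
        (Function.update l p
          { l p with phase := .scan d (log ++ [g (Fin.ofNat (r + 2) log.length)]) })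
  | eval (p : Fin n) (d : D) (log : List (Entry D)) (h : (l p).phase = .scan d log)
      (hge : logSize n r ≤ log.length) :
      Move m b g l (some (.compute p)) g (Function.update l p ((l p).eval n m b d log))
  | publish (p : Fin n) (d : D) (h : (l p).phase = .publish d) :
      Move m b g l (some (.compute p)) (Function.update g (Fin.last (r + 1)) ⟨none, (l p).hist, 0⟩)
        (Function.update l p { l p with phase := .done d })
  | respond (p : Fin n) (d : D) (h : (l p).phase = .done d) :
      Move m b g l (some (.respond p d)) g (Function.update l p { l p with phase := .idle })

/-- An execution of the algorithm, extended by stuttering to an infinite sequence. -/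
structure Run (D : Type u) (n m b r : ℕ) where
  reg : ℕ → Fin (r + 2) → Entry D
  loc : ℕ → Fin n → Local D r
  ev : ℕ → Option (Event D n)
  reg_zero : reg 0 = fun _ => ⟨none, [], 0⟩
  loc_zero : loc 0 = fun _ => ⟨0, 0, [], .idle⟩
  move : ∀ i, Move m b (reg i) (loc i) (ev i) (reg (i + 1)) (loc (i + 1))

lemma conclude_phase_ne_idle (l : Local D r) (d : D) (κ : Fin (r + 1) → Option (ℕ × D)) :
    (l.conclude m b d κ).phase ≠ .idle := by
  unfold Local.conclude Local.finish
  split_ifs <;> simp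

lemma eval_phase_ne_idle (l : Local D r) (d : D) (log : List (Entry D)) :
    (l.eval n m b d log).phase ≠ .idle := by
  unfold Local.eval
  split_ifs
  · simp [Local.finish]
  · exact conclude_phase_ne_idle _ _ _
  · simp

lemma active_update_iff {a : Fin n → Bool} {l : Fin n → Local D r} {p : Fin n} {x : Bool}
    {l' : Local D r} (hC : ∀ q, a q = false ↔ (l q).phase = .idle)
    (h : x = false ↔ l'.phase = .idle) (q : Fin n) :
    Function.update a p x q = false ↔ (Function.update l p l' q).phase = .idle := by
  by_cases hq : q = p
  · subst hq; simpa using h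
  · simpa [Function.update_of_ne hq] using hC q

lemma active_iff_update {a : Fin n → Bool} {l : Fin n → Local D r} {p : Fin n}
    {l' : Local D r} (hC : ∀ q, a q = false ↔ (l q).phase = .idle)
    (h : a p = false ↔ l'.phase = .idle) (q : Fin n) :
    a q = false ↔ (Function.update l p l' q).phase = .idle := by
  by_cases hq : q = p
  · subst hq; simpa using h
  · simpa [Function.update_of_ne hq] using hC q

/-- `Move` has no activity flags. The flags are recoverable because a process is idle exactly when
its phase is, and this invariant has to be carried along with the translation. -/
lemma Move.of_step {C C' : Config (algorithm D n m b r) n} {e : Event D n} (h : Step C e C')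
    (hC : ∀ p, C.active p = false ↔ Local.phase (C.loc p) = .idle) :
    Move m b C.reg C.loc (some e) C'.reg C'.loc ∧
      ∀ p, C'.active p = false ↔ Local.phase (C'.loc p) = .idle := by
  cases h with
  | invoke p v hp =>
    exact ⟨.invoke p v ((hC p).1 hp), active_update_iff hC (by simp [algorithm])⟩
  | read p j next hp ha =>
    cases hph : Local.phase (C.loc p) <;> simp only [algorithm, hph] at ha <;>
      try contradiction
    split_ifs at ha with hlt
    cases ha
    exact ⟨.read p _ _ hph hlt, active_iff_update hC (by simp [hp])⟩
  | write p j x next hp ha =>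
    cases hph : Local.phase (C.loc p) <;> simp only [algorithm, hph] at ha <;>
      try contradiction
    · cases ha
      exact ⟨.write p _ hph, active_iff_update hC (by simp [hp])⟩
    · split_ifs at ha
    · cases ha
      exact ⟨.publish p _ hph, active_iff_update hC (by simp [hp])⟩
  | internal p next hp ha =>
    cases hph : Local.phase (C.loc p) <;> simp only [algorithm, hph] at ha <;>
      try contradiction
    · exact absurd ((hC p).2 hph) (by simp [hp])
    · split_ifs at ha with hlt
      cases ha
      exact ⟨.eval p _ _ hph (not_lt.1 hlt),
        active_iff_update hC (by simp [hp, eval_phase_ne_idle])⟩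
  | respond p d next hp ha =>
    cases hph : Local.phase (C.loc p) <;> simp only [algorithm, hph] at ha <;>
      try contradiction
    · split_ifs at ha
    · cases ha
      exact ⟨.respond p _ hph, active_update_iff hC (by simp)⟩

lemma active_iff (α : Execution (algorithm D n m b r) n) (i : ℕ) (hi : (i : ℕ∞) ≤ α.len)
    (p : Fin n) : (α.conf i).active p = false ↔ Local.phase ((α.conf i).loc p) = .idle := by
  induction i generalizing p with
  | zero => rw [α.conf_zero]; simp [Config.init, algorithm]
  | succ i ih =>
    have hi' : (i : ℕ∞) < α.len := lt_of_lt_of_le (by exact_mod_cast Nat.lt_succ_self i) hi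
    exact (Move.of_step (α.step i hi') (ih hi'.le)).2 p

open Classical in
/-- The run that corresponds to an execution. -/
noncomputable def Run.ofExecution (α : Execution (algorithm D n m b r) n) : Run D n m b r where
  -- The configurations of a finite execution are arbitrary beyond its length, so the last genuine
  -- one is repeated.
  reg i := (α.conf (if (i : ℕ∞) ≤ α.len then i else α.len.toNat)).reg
  loc i := (α.conf (if (i : ℕ∞) ≤ α.len then i else α.len.toNat)).loc
  ev i := if (i : ℕ∞) < α.len then some (α.event i) else none
  reg_zero := by simp [α.conf_zero, Config.init, algorithm]
  loc_zero := by simp [α.conf_zero, Config.init, algorithm]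
  move i := by
    by_cases hi : (i : ℕ∞) < α.len
    · have hi' : ((i + 1 : ℕ) : ℕ∞) ≤ α.len := by
        push_cast
        exact Order.add_one_le_of_lt hi
      rw [if_pos hi.le, if_pos hi', if_pos hi]
      exact (Move.of_step (α.step i hi) (active_iff α i hi.le)).1
    · have hlen : α.len ≤ i := not_lt.1 hi
      have hi' : ¬ ((i + 1 : ℕ) : ℕ∞) ≤ α.len := fun h =>
        hi (lt_of_lt_of_le (by exact_mod_cast Nat.lt_succ_self i) h)
      rw [if_neg hi, if_neg hi']
      have : (if (i : ℕ∞) ≤ α.len then i else α.len.toNat) = α.len.toNat := by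
        split_ifs with h
        · rw [le_antisymm hlen h]; simp
        · rfl
      rw [this]
      exact .stutter

lemma Run.ofExecution_ev_eq (α : Execution (algorithm D n m b r) n) (i : ℕ) (e : Event D n) :
    (Run.ofExecution α).ev i = some e ↔ α.Occurs i e := by
  simp only [Run.ofExecution, Execution.Occurs]
  split_ifs with h <;> simp [h]

/-- The steps of a process `p` in local state `l`. -/
inductive LocalMove (m b : ℕ) (p : Fin n) (g : Fin (r + 2) → Entry D) (l : Local D r) :
    Event D n → Local D r → Prop
  | invoke (v : D) (h : l.phase = .idle) :
      LocalMove m b p g l (.invoke p v) { l with phase := .update v }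
  | write (d : D) (h : l.phase = .update d) :
      LocalMove m b p g l (.compute p) { l with ts := l.ts + 1, phase := .scan d [] }
  | read (d : D) (log : List (Entry D)) (h : l.phase = .scan d log)
      (hlt : log.length < logSize n r) :
      LocalMove m b p g l (.compute p)
        { l with phase := .scan d (log ++ [g (Fin.ofNat (r + 2) log.length)]) }
  | eval (d : D) (log : List (Entry D)) (h : l.phase = .scan d log)
      (hge : logSize n r ≤ log.length) :
      LocalMove m b p g l (.compute p) (l.eval n m b d log)
  | publish (d : D) (h : l.phase = .publish d) :
      LocalMove m b p g l (.compute p) { l with phase := .done d }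
  | respond (d : D) (h : l.phase = .done d) :
      LocalMove m b p g l (.respond p d) { l with phase := .idle }

namespace Run

variable (ρ : Run D n m b r)

/-- Process `p` performs step `i`. -/
def Acts (p : Fin n) (i : ℕ) : Prop := ∃ e, ρ.ev i = some e ∧ e.owner = p

lemma local_step (i : ℕ) (p : Fin n) :
    (¬ ρ.Acts p i ∧ ρ.loc (i + 1) p = ρ.loc i p) ∨
      ∃ e, ρ.ev i = some e ∧ e.owner = p ∧
        LocalMove m b p (ρ.reg i) (ρ.loc i p) e (ρ.loc (i + 1) p) := by
  have h := ρ.move i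
  unfold Acts
  generalize ρ.reg (i + 1) = g', ρ.loc (i + 1) = l', ρ.ev i = e at h ⊢
  cases h with
  | stutter => left; simp
  | invoke q v h =>
    by_cases hpq : p = q
    · subst hpq; right; exact ⟨_, rfl, rfl, by simpa using LocalMove.invoke v h⟩
    · left; simpa [Function.update_of_ne hpq, Event.owner] using fun h => hpq h.symm
  | write q d h =>
    by_cases hpq : p = q
    · subst hpq; right; exact ⟨_, rfl, rfl, by simpa using LocalMove.write d h⟩
    · left; simpa [Function.update_of_ne hpq, Event.owner] using fun h => hpq h.symm
  | read q d log h hlt =>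
    by_cases hpq : p = q
    · subst hpq; right
      exact ⟨_, rfl, rfl, by simpa using LocalMove.read (g := ρ.reg i) d log h hlt⟩
    · left; simpa [Function.update_of_ne hpq, Event.owner] using fun h => hpq h.symm
  | eval q d log h hge =>
    by_cases hpq : p = q
    · subst hpq; right; exact ⟨_, rfl, rfl, by simpa using LocalMove.eval d log h hge⟩
    · left; simpa [Function.update_of_ne hpq, Event.owner] using fun h => hpq h.symm
  | publish q d h =>
    by_cases hpq : p = q
    · subst hpq; right; exact ⟨_, rfl, rfl, by simpa using LocalMove.publish d h⟩
    · left; simpa [Function.update_of_ne hpq, Event.owner] using fun h => hpq h.symm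
  | respond q d h =>
    by_cases hpq : p = q
    · subst hpq; right; exact ⟨_, rfl, rfl, by simpa using LocalMove.respond d h⟩
    · left; simpa [Function.update_of_ne hpq, Event.owner] using fun h => hpq h.symm

lemma local_move {i : ℕ} {p : Fin n} {e : Event D n} (h : ρ.ev i = some e) (hp : e.owner = p) :
    LocalMove m b p (ρ.reg i) (ρ.loc i p) e (ρ.loc (i + 1) p) := by
  rcases ρ.local_step i p with ⟨h', -⟩ | ⟨e', he', -, h'⟩
  · exact absurd ⟨e, h, hp⟩ h'
  · rw [h] at he'
    cases he'
    exact h'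

lemma reg_step (i : ℕ) :
    ρ.reg (i + 1) = ρ.reg i ∨
    (∃ p d, ρ.ev i = some (.compute p) ∧ (ρ.loc i p).phase = .update d ∧
      ρ.reg (i + 1) =
        Function.update (ρ.reg i) (ρ.loc i p).idx.castSucc ((ρ.loc i p).entry d)) ∨
    (∃ p d, ρ.ev i = some (.compute p) ∧ (ρ.loc i p).phase = .publish d ∧
      ρ.reg (i + 1) =
        Function.update (ρ.reg i) (Fin.last (r + 1)) ⟨none, (ρ.loc i p).hist, 0⟩) := by
  have h := ρ.move i
  generalize ρ.reg (i + 1) = g', ρ.loc (i + 1) = l', ρ.ev i = e at h ⊢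
  cases h with
  | stutter | invoke | read | eval | respond => left; rfl
  | write q d h => right; left; exact ⟨q, d, rfl, h, rfl⟩
  | publish q d h => right; right; exact ⟨q, d, rfl, h, rfl⟩

end Run

/-! ### Invariants and validity -/

lemma eval_cases (l : Local D r) (d : D) (log : List (Entry D)) :
    (∃ v, Adoptable log l.hist.length v ∧ l.eval n m b d log = l.finish v) ∨
    ((∀ v, ¬ Adoptable log l.hist.length v) ∧
      ∃ s : Fin (r + 1) → Entry D, Uniform n log s ∧
        l.eval n m b d log = l.conclude m b d fun j => (s j).key) ∨
    ((∀ v, ¬ Adoptable log l.hist.length v) ∧ (∀ s : Fin (r + 1) → Entry D, ¬ Uniform n log s) ∧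
      l.eval n m b d log = { l with phase := .scan d [] }) := by
  unfold Local.eval
  split_ifs with h₁ h₂
  · exact .inl ⟨_, h₁.choose_spec, rfl⟩
  · exact .inr (.inl ⟨not_exists.1 h₁, _, h₂.choose_spec, rfl⟩)
  · exact .inr (.inr ⟨not_exists.1 h₁, not_exists.1 h₂, rfl⟩)

lemma conclude_cases (l : Local D r) (d : D) (κ : Fin (r + 1) → Option (ℕ × D)) :
    (Decisive m κ l.hist.length ∧
      l.conclude m b d κ = l.finish (newPref b κ l.hist.length d)) ∨
    (¬ Decisive m κ l.hist.length ∧ l.conclude m b d κ =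
      { l with idx := l.idx + 1, phase := .update (newPref b κ l.hist.length d) }) := by
  unfold Local.conclude
  split_ifs with h
  · exact .inl ⟨h, rfl⟩
  · exact .inr ⟨h, rfl⟩

open Classical in
lemma exists_key_of_count_pos {κ : Fin (r + 1) → Option (ℕ × D)} {t : ℕ} {d : D}
    (h : 0 < count κ t d) : ∃ j, κ j = some (t, d) := by
  obtain ⟨j, hj⟩ := Finset.card_pos.1 h
  exact ⟨j, (Finset.mem_filter.1 hj).2⟩

lemma newPref_cases (b : ℕ) (κ : Fin (r + 1) → Option (ℕ × D)) (t : ℕ) (d : D) :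
    b < count κ t (newPref b κ t d) ∨ (newPref b κ t d = d ∧ ∀ v, ¬ b < count κ t v) := by
  unfold newPref
  split_ifs with h₁ h₂
  · exact .inl h₁
  · exact .inl h₂.choose_spec
  · exact .inr ⟨rfl, not_exists.1 h₂⟩

lemma Uniform.mem {log : List (Entry D)} {s : Fin (r + 1) → Entry D} (h : Uniform n log s)
    (j : Fin (r + 1)) : s j ∈ log :=
  List.mem_of_getElem? (h 0 (by omega) j)

/-- `P` holds for the outputs recorded in `x` and `Q` for its preference. -/
def Entry.Sound (P Q : ℕ → D → Prop) (x : Entry D) : Prop :=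
  (∀ t v, x.hist[t]? = some v → P t v) ∧
    ∀ t v, x.key = some (t, v) → Q t v ∧ x.hist.length = t

/-- `P` holds for the outputs known in `l` and `Q` for the preferences. -/
def Local.Sound (P Q : ℕ → D → Prop) (l : Local D r) : Prop :=
  (∀ t v, l.hist[t]? = some v → P t v) ∧
    match l.phase with
    | .idle => True
    | .update d => Q l.hist.length d
    | .scan d log => Q l.hist.length d ∧ ∀ x ∈ log, x.Sound P Q
    | .publish d => ∃ t, l.hist.length = t + 1 ∧ l.hist[t]? = some d
    | .done d => ∃ t, l.hist.length = t + 1 ∧ l.hist[t]? = some d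

lemma Local.Sound.finish {P Q : ℕ → D → Prop} {l : Local D r} (h : l.Sound P Q) {v : D}
    (hv : P l.hist.length v) : (l.finish v).Sound P Q := by
  refine ⟨fun t w hw => ?_, l.hist.length, by simp [Local.finish], by simp [Local.finish]⟩
  simp only [Local.finish] at hw
  rcases lt_trichotomy t l.hist.length with ht | ht | ht
  · rw [List.getElem?_append_left ht] at hw
    exact h.1 t w hw
  · subst ht
    simp at hw
    exact hw ▸ hv
  · rw [List.getElem?_eq_none (by simp; omega)] at hw
    cases hw

namespace Run

variable (ρ : Run D n m b r)

/-- At step `e`, process `x` with preference `d` completes a scan that returns `s`. -/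
def Concludes (e : ℕ) (x : Fin n) (d : D) (s : Fin (r + 1) → Entry D) : Prop :=
  ∃ log, (ρ.loc e x).phase = .scan d log ∧ logSize n r ≤ log.length ∧
    ρ.ev e = some (.compute x) ∧ (∀ v, ¬ Adoptable log (ρ.loc e x).hist.length v) ∧
    Uniform n log s ∧ ρ.loc (e + 1) x = (ρ.loc e x).conclude m b d fun j => (s j).key

/-- New information enters at two places only: inputs at invocations and outputs at decisive scans.
Everything else is copied, adoption from a recorded history and a changed preference from a
component that holds it. Suitable `P` and `Q` yield validity, agreement and the coherence of keys
with histories. -/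
theorem sound {P Q : ℕ → D → Prop}
    (hinv : ∀ i p v, ρ.ev i = some (.invoke p v) → Q (ρ.loc i p).hist.length v)
    (hdec : ∀ e x d s, ρ.Concludes e x d s →
      Decisive m (fun j => (s j).key) (ρ.loc e x).hist.length →
      Q (ρ.loc e x).hist.length (newPref b (fun j => (s j).key) (ρ.loc e x).hist.length d) →
      P (ρ.loc e x).hist.length (newPref b (fun j => (s j).key) (ρ.loc e x).hist.length d))
    (i : ℕ) : (∀ j, (ρ.reg i j).Sound P Q) ∧ ∀ p, (ρ.loc i p).Sound P Q := by
  induction i with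
  | zero =>
    constructor
    · intro j; rw [ρ.reg_zero]; constructor <;> simp
    · intro p; rw [ρ.loc_zero]; constructor <;> simp
  | succ i ih =>
    obtain ⟨ihr, ihl⟩ := ih
    constructor
    · intro j
      rcases ρ.reg_step i with h | ⟨p, d, -, hph, h⟩ | ⟨p, d, -, hph, h⟩
      · rw [h]; exact ihr j
      · rw [h, Function.update_apply]
        split_ifs
        · obtain ⟨h1, h2⟩ := ihl p
          rw [hph] at h2
          refine ⟨h1, fun t v hv => ?_⟩
          simp only [Local.entry, Option.some.injEq, Prod.mk.injEq] at hv
          obtain ⟨rfl, rfl⟩ := hv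
          exact ⟨h2, rfl⟩
        · exact ihr j
      · rw [h, Function.update_apply]
        split_ifs
        · exact ⟨(ihl p).1, by simp⟩
        · exact ihr j
    · intro p
      rcases ρ.local_step i p with ⟨-, h⟩ | ⟨e, he, -, h⟩
      · rw [h]; exact ihl p
      have hl := ihl p
      have hc : ∀ d log (s : Fin (r + 1) → Entry D), (ρ.loc i p).phase = .scan d log →
          logSize n r ≤ log.length → ρ.ev i = some (.compute p) →
          (∀ v, ¬ Adoptable log (ρ.loc i p).hist.length v) → Uniform n log s →
          ρ.loc (i + 1) p = (ρ.loc i p).conclude m b d (fun j => (s j).key) →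
          (ρ.loc (i + 1) p).Sound P Q := by
        intro d log s h1 h2 h3 h4 h5 h6
        have hl2 := hl.2
        rw [h1] at hl2
        have hQ : Q (ρ.loc i p).hist.length
            (newPref b (fun j => (s j).key) (ρ.loc i p).hist.length d) := by
          rcases newPref_cases b (fun j => (s j).key) (ρ.loc i p).hist.length d with h | h
          · obtain ⟨j, hj⟩ := exists_key_of_count_pos (Nat.zero_lt_of_lt h)
            exact ((hl2.2 _ (h5.mem j)).2 _ _ hj).1
          · rw [h.1]; exact hl2.1
        rw [h6]
        rcases conclude_cases (m := m) (b := b) (ρ.loc i p) d (fun j => (s j).key) with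
          ⟨hD, h⟩ | ⟨hD, h⟩
        · rw [h]
          exact hl.finish (hdec i p d s ⟨log, h1, h2, h3, h4, h5, h6⟩ hD hQ)
        · rw [h]
          exact ⟨hl.1, hQ⟩
      generalize hl' : ρ.loc (i + 1) p = l' at h hc ⊢
      cases h with
      | invoke v h => exact ⟨hl.1, hinv i p v he⟩
      | write d h =>
        refine ⟨hl.1, ?_⟩
        have := hl.2
        rw [h] at this
        exact ⟨this, by simp⟩
      | read d log h hlt =>
        refine ⟨hl.1, ?_⟩
        have := hl.2
        rw [h] at this
        refine ⟨this.1, fun x hx => ?_⟩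
        rcases List.mem_append.1 hx with hx | hx
        · exact this.2 x hx
        · rw [List.mem_singleton.1 hx]; exact ihr _
      | eval d log h hge =>
        rcases eval_cases (n := n) (m := m) (b := b) (ρ.loc i p) d log with
          ⟨v, ⟨x, hx, hxv⟩, hv⟩ | ⟨hA, s, hs, hv⟩ | ⟨-, -, hv⟩
        · rw [hv]
          have := hl.2
          rw [h] at this
          exact hl.finish ((this.2 x hx).1 _ _ hxv)
        · exact hc d log s h hge he hA hs hv
        · rw [hv]
          have := hl.2
          rw [h] at this
          exact ⟨hl.1, this.1, by simp⟩
      | publish d h =>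
        have := hl.2
        rw [h] at this
        exact ⟨hl.1, this⟩
      | respond d h => exact ⟨hl.1, trivial⟩

/-- With trivial `P` and `Q`, what remains of soundness is the clause that ties the operation number
of a key to its history. -/
lemma length_hist_of_key {i : ℕ} {j : Fin (r + 2)} {t : ℕ} {d : D}
    (h : (ρ.reg i j).key = some (t, d)) : (ρ.reg i j).hist.length = t :=
  (((ρ.sound (P := fun _ _ => True) (Q := fun _ _ => True) (fun _ _ _ _ => trivial)
    (fun _ _ _ _ _ _ _ => trivial) i).1 j).2 t d h).2

lemma respond_mem {P : ℕ → D → Prop} {i : ℕ} {p : Fin n} {d : D}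
    (hs : (ρ.loc i p).Sound P (Q := Q)) (h : ρ.ev i = some (.respond p d)) :
    ∃ t, (ρ.loc i p).hist.length = t + 1 ∧ P t d := by
  have hm := ρ.local_move (p := p) h rfl
  generalize ρ.loc (i + 1) p = l' at hm
  cases hm with
  | respond _ h' =>
    have := hs.2
    rw [h'] at this
    obtain ⟨t, ht, htd⟩ := this
    exact ⟨t, ht, hs.1 t d htd⟩

end Run

/-- `1` if an operation is in progress whose output is not yet determined, and `0` otherwise. -/
def Phase.busy : Phase D → ℕ
  | .update _ => 1
  | .scan _ _ => 1
  | _ => 0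

lemma conclude_count (l : Local D r) (d : D) (κ : Fin (r + 1) → Option (ℕ × D)) :
    (l.conclude m b d κ).hist.length + (l.conclude m b d κ).phase.busy = l.hist.length + 1 := by
  rcases conclude_cases (m := m) (b := b) l d κ with ⟨-, h⟩ | ⟨-, h⟩ <;> rw [h] <;>
    simp [Local.finish, Phase.busy]

lemma eval_count (l : Local D r) (d : D) (log : List (Entry D)) :
    (l.eval n m b d log).hist.length + (l.eval n m b d log).phase.busy = l.hist.length + 1 := by
  rcases eval_cases (n := n) (m := m) (b := b) l d log with
    ⟨v, -, h⟩ | ⟨-, s, -, h⟩ | ⟨-, -, h⟩ <;> rw [h]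
  · simp [Local.finish, Phase.busy]
  · exact conclude_count _ _ _
  · simp [Phase.busy]

namespace Run

variable (ρ : Run D n m b r)

/-- The history grows when the output is determined, before the response; `busy` accounts for an
operation that has been invoked but is still undetermined. -/
lemma ncard_invocations (p : Fin n) (i : ℕ) :
    {j : ℕ | j < i ∧ ∃ v, ρ.ev j = some (.invoke p v)}.ncard =
      (ρ.loc i p).hist.length + (ρ.loc i p).phase.busy := by
  induction i with
  | zero => simp [ρ.loc_zero, Phase.busy]
  | succ i ih =>
    have hfin : {j : ℕ | j < i ∧ ∃ v, ρ.ev j = some (.invoke p v)}.Finite :=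
      (Set.finite_lt_nat i).subset fun j hj => hj.1
    by_cases hi : ∃ v, ρ.ev i = some (.invoke p v)
    · have : {j : ℕ | j < i + 1 ∧ ∃ v, ρ.ev j = some (.invoke p v)} =
          insert i {j : ℕ | j < i ∧ ∃ v, ρ.ev j = some (.invoke p v)} := by
        ext j
        simp only [Set.mem_ofPred_eq, Set.mem_insert_iff, Nat.lt_succ_iff_lt_or_eq]
        constructor
        · rintro ⟨h | h, h'⟩
          · exact .inr ⟨h, h'⟩
          · exact .inl h
        · rintro (rfl | h)
          · exact ⟨.inr rfl, hi⟩
          · exact ⟨.inl h.1, h.2⟩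
      rw [this, Set.ncard_insert_of_notMem (by simp) hfin, ih]
      obtain ⟨v, hv⟩ := hi
      have hm := ρ.local_move (p := p) hv rfl
      generalize ρ.loc (i + 1) p = l' at hm
      cases hm with
      | invoke _ h => simp [h, Phase.busy]
    · have : {j : ℕ | j < i + 1 ∧ ∃ v, ρ.ev j = some (.invoke p v)} =
          {j : ℕ | j < i ∧ ∃ v, ρ.ev j = some (.invoke p v)} := by
        ext j
        simp only [Set.mem_ofPred_eq, Nat.lt_succ_iff_lt_or_eq]
        constructor
        · rintro ⟨h | h, h'⟩
          · exact ⟨h, h'⟩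
          · exact absurd (h ▸ h') hi
        · exact fun h => ⟨.inl h.1, h.2⟩
      rw [this, ih]
      rcases ρ.local_step i p with ⟨-, h⟩ | ⟨e, he, -, h⟩
      · rw [h]
      generalize ρ.loc (i + 1) p = l' at h ⊢
      cases h with
      | invoke v h => exact absurd ⟨v, he⟩ hi
      | write d h => simp [h, Phase.busy]
      | read d log h hlt => simp [h, Phase.busy]
      | eval d log h hge => rw [eval_count, h]; simp [Phase.busy]
      | publish d h => simp [h, Phase.busy]
      | respond d h => simp [h, Phase.busy]

lemma invocations_ofExecution (α : Execution (algorithm D n m b r) n) (p : Fin n) (i : ℕ) :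
    α.invocations p i = ((ofExecution α).loc (i + 1) p).hist.length +
      ((ofExecution α).loc (i + 1) p).phase.busy := by
  rw [← ncard_invocations]
  simp only [Execution.invocations, ofExecution_ev_eq, Nat.lt_succ_iff]

lemma invocations_of_invoke (α : Execution (algorithm D n m b r) n) {p : Fin n} {i : ℕ} {v : D}
    (h : (ofExecution α).ev i = some (.invoke p v)) :
    α.invocations p i = ((ofExecution α).loc i p).hist.length + 1 := by
  rw [invocations_ofExecution]
  have hm := (ofExecution α).local_move (p := p) h rfl
  generalize (ofExecution α).loc (i + 1) p = l' at hm
  cases hm with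
  | invoke _ h => simp [Phase.busy]

lemma invocations_of_respond (α : Execution (algorithm D n m b r) n) {p : Fin n} {i : ℕ} {v : D}
    (h : (ofExecution α).ev i = some (.respond p v)) :
    α.invocations p i = ((ofExecution α).loc i p).hist.length := by
  rw [invocations_ofExecution]
  have hm := (ofExecution α).local_move (p := p) h rfl
  generalize (ofExecution α).loc (i + 1) p = l' at hm
  cases hm with
  | respond _ h => simp [Phase.busy]

end Run

theorem validity : Validity (algorithm D n m b r) n := by
  rintro α t d ⟨p, i, hi, rfl⟩
  rw [← Run.ofExecution_ev_eq] at hi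
  -- Histories are indexed from `0`, operations from `1`; hence the shift by one.
  have hs := ((Run.ofExecution α).sound (P := fun t v => v ∈ α.inputs (t + 1))
    (Q := fun t v => v ∈ α.inputs (t + 1))
    (fun i p v h => ⟨p, i, (Run.ofExecution_ev_eq α i _).1 h, Run.invocations_of_invoke α h⟩)
    (fun e x d s _ _ h => h) i).2 p
  obtain ⟨t, ht, hd⟩ := Run.respond_mem _ hs hi
  rw [Run.invocations_of_respond α hi, ht]
  exact hd

/-! ### Correctness of anonymous scans -/

/-- The local state without the reads of an unfinished scan. -/
def Local.core (l : Local D r) : Local D r :=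
  { l with phase := match l.phase with
    | .scan d _ => .scan d []
    | ph => ph }

lemma core_eq_self {l : Local D r} (h : ∀ d log, l.phase ≠ .scan d log) : l.core = l := by
  obtain ⟨idx, ts, hist, ph⟩ := l
  cases ph <;> simp_all [Local.core]

lemma core_of_scan {l : Local D r} {d : D} {log : List (Entry D)} (h : l.phase = .scan d log) :
    l.core = { l with phase := .scan d [] } := by
  simp [Local.core, h]

lemma core_phase_scan {l : Local D r} {d : D} {log : List (Entry D)}
    (h : l.core.phase = .scan d log) : ∃ log', l.phase = .scan d log' := by
  obtain ⟨idx, ts, hist, ph⟩ := l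
  cases ph <;> simp_all [Local.core]

@[simp] lemma core_hist (l : Local D r) : l.core.hist = l.hist := rfl

lemma conclude_phase_ne_scan (l : Local D r) (d : D) (κ : Fin (r + 1) → Option (ℕ × D)) (d' : D)
    (log : List (Entry D)) : (l.conclude m b d κ).phase ≠ .scan d' log := by
  rcases conclude_cases (m := m) (b := b) l d κ with ⟨-, h⟩ | ⟨-, h⟩ <;>
    · rw [h]; simp [Local.finish]

lemma eval_ts (l : Local D r) (d : D) (log : List (Entry D)) :
    (l.eval n m b d log).ts = l.ts := by
  rcases eval_cases (n := n) (m := m) (b := b) l d log with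
    ⟨v, -, h⟩ | ⟨-, s, -, h⟩ | ⟨-, -, h⟩ <;> rw [h]
  · rfl
  · rcases conclude_cases (m := m) (b := b) l d (fun j => (s j).key) with ⟨-, h⟩ | ⟨-, h⟩ <;>
      simp [h, Local.finish]

namespace Run

variable (ρ : Run D n m b r)

/-- Together with the increment at each write, this shows that a process never writes the same entry
twice. -/
lemma ts_mono (p : Fin n) : Monotone fun i => (ρ.loc i p).ts := by
  refine monotone_nat_of_le_succ fun i => ?_
  rcases ρ.local_step i p with ⟨-, h⟩ | ⟨e, -, -, h⟩
  · rw [h]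
  · generalize ρ.loc (i + 1) p = l' at h ⊢
    cases h with
    | write d h => simp
    | eval d log h hge => rw [eval_ts]
    | _ => rfl

lemma loc_of_write {i : ℕ} {p : Fin n} {d : D} (he : ρ.ev i = some (.compute p))
    (hp : (ρ.loc i p).phase = .update d) : ρ.loc (i + 1) p =
      { ρ.loc i p with ts := (ρ.loc i p).ts + 1, phase := .scan d [] } := by
  have h := ρ.local_move (p := p) he rfl
  generalize ρ.loc (i + 1) p = l' at h
  cases h with
  | write d' h => rw [hp] at h; cases h; rfl
  | _ => simp_all

/-- Every change of a component is a write by some process. -/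
lemma exists_write {i i' : ℕ} (hi : i < i') {j : Fin (r + 1)} {x : Entry D}
    (h : ρ.reg i j.castSucc ≠ x) (h' : ρ.reg i' j.castSucc = x) :
    ∃ w p d, i ≤ w ∧ w < i' ∧ ρ.ev w = some (.compute p) ∧ (ρ.loc w p).phase = .update d ∧
      (ρ.loc w p).idx = j ∧ (ρ.loc w p).entry d = x := by
  obtain ⟨k, rfl⟩ := Nat.exists_eq_add_of_lt hi
  clear hi
  induction k with
  | zero =>
    rcases ρ.reg_step i with hs | ⟨p, d, he, hp, hs⟩ | ⟨p, d, he, hp, hs⟩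
    · exact absurd (hs ▸ h') h
    · rw [Nat.add_zero, hs, Function.update_apply] at h'
      split_ifs at h' with hj
      · exact ⟨i, p, d, le_rfl, by omega, he, hp, (Fin.castSucc_injective _ hj).symm, h'⟩
      · exact absurd h' h
    · rw [Nat.add_zero, hs, Function.update_of_ne (Fin.castSucc_lt_last j).ne] at h'
      exact absurd h' h
  | succ k ih =>
    by_cases hk : ρ.reg (i + k + 1) j.castSucc = x
    · obtain ⟨w, p, d, h1, h2, h3⟩ := ih hk
      exact ⟨w, p, d, h1, by omega, h3⟩
    · rcases ρ.reg_step (i + k + 1) with hs | ⟨p, d, he, hp, hs⟩ | ⟨p, d, he, hp, hs⟩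
      · rw [← add_assoc, hs] at h'; exact absurd h' hk
      · rw [← add_assoc, hs, Function.update_apply] at h'
        split_ifs at h' with hj
        · exact ⟨i + k + 1, p, d, by omega, by omega, he, hp,
            (Fin.castSucc_injective _ hj).symm, h'⟩
        · exact absurd h' hk
      · rw [← add_assoc, hs, Function.update_of_ne (Fin.castSucc_lt_last j).ne] at h'
        exact absurd h' hk

/-- The log of a scan consists of values read one after the other during the scan. -/
lemma exists_read_times (i : ℕ) (p : Fin n) (d : D) (log : List (Entry D))
    (h : (ρ.loc i p).phase = .scan d log) : ∃ f : ℕ → ℕ,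
      (∀ l < log.length, f l < i ∧ log[l]? = some (ρ.reg (f l) (Fin.ofNat (r + 2) l)) ∧
        ∀ i', f l ≤ i' → i' ≤ i → (ρ.loc i' p).core = (ρ.loc i p).core) ∧
      ∀ l l', l < l' → l' < log.length → f l < f l' := by
  induction i generalizing log d with
  | zero => rw [ρ.loc_zero] at h; cases h
  | succ i ih =>
    -- An empty log imposes no condition; this covers the start of a scan and its restart after a
    -- failed evaluation.
    have hnil : log = [] → ∃ f : ℕ → ℕ,
      (∀ l < log.length, f l < i + 1 ∧ log[l]? = some (ρ.reg (f l) (Fin.ofNat (r + 2) l)) ∧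
        ∀ i', f l ≤ i' → i' ≤ i + 1 → (ρ.loc i' p).core = (ρ.loc (i + 1) p).core) ∧
      ∀ l l', l < l' → l' < log.length → f l < f l' := by
      rintro rfl
      exact ⟨id, by simp, by simp⟩
    rcases ρ.local_step i p with ⟨-, hl⟩ | ⟨e, -, -, hm⟩
    · rw [hl] at h
      obtain ⟨f, hf, hf'⟩ := ih d log h
      refine ⟨f, fun l hlt => ⟨(hf l hlt).1.trans (Nat.lt_succ_self i), (hf l hlt).2.1,
        fun i' h1 h2 => ?_⟩, hf'⟩
      rw [hl]
      rcases Nat.le_succ_iff.1 h2 with h2 | rfl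
      · exact (hf l hlt).2.2 i' h1 h2
      · rw [hl]
    · generalize hl' : ρ.loc (i + 1) p = l' at hm h hnil ⊢
      cases hm with
      | invoke v h' => cases h
      | write d' h' => cases h; exact hnil rfl
      | read d' log' h' hlt =>
        cases h
        obtain ⟨f, hf, hf'⟩ := ih d log' h'
        have hcore : (ρ.loc (i + 1) p).core = (ρ.loc i p).core := by
          rw [hl', core_of_scan h']; rfl
        rw [← hl', hcore]
        refine ⟨Function.update f log'.length i, fun l hlt => ?_, fun l l' hll hlt => ?_⟩
        · rw [List.length_append, List.length_singleton] at hlt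
          rcases Nat.lt_succ_iff_lt_or_eq.1 hlt with hlt | rfl
          · rw [Function.update_of_ne hlt.ne, List.getElem?_append_left hlt]
            refine ⟨(hf l hlt).1.trans (Nat.lt_succ_self i), (hf l hlt).2.1, fun i' h1 h2 => ?_⟩
            rcases Nat.le_succ_iff.1 h2 with h2 | rfl
            · exact (hf l hlt).2.2 i' h1 h2
            · exact hcore
          · rw [Function.update_self]
            refine ⟨Nat.lt_succ_self i, by simp, fun i' h1 h2 => ?_⟩
            rcases Nat.le_succ_iff.1 h2 with h2 | rfl
            · rw [le_antisymm h2 h1]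
            · exact hcore
        · rw [List.length_append, List.length_singleton] at hlt
          rcases Nat.lt_succ_iff_lt_or_eq.1 hlt with hlt | rfl
          · rw [Function.update_of_ne hlt.ne, Function.update_of_ne (hll.trans hlt).ne]
            exact hf' l l' hll hlt
          · rw [Function.update_self, Function.update_of_ne hll.ne]
            exact (hf l hll).1
      | eval d' log' h' hge =>
        rcases eval_cases (n := n) (m := m) (b := b) (ρ.loc i p) d' log' with
          ⟨v, -, hv⟩ | ⟨-, s, -, hv⟩ | ⟨-, -, hv⟩ <;> rw [hv] at h
        · cases h
        · exact absurd h (conclude_phase_ne_scan _ _ _ _ _)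
        · cases h; exact hnil rfl
      | publish d' h' => cases h
      | respond d' h' => cases h

/-- A scan that succeeds returns a vector that was contained in the components at some moment
during the scan. -/
theorem exists_snapshot {e : ℕ} {x : Fin n} {d : D} {s : Fin (r + 1) → Entry D}
    (h : ρ.Concludes e x d s) : ∃ τ ≤ e, (∀ j : Fin (r + 1), ρ.reg τ j.castSucc = s j) ∧
      ∀ i, τ ≤ i → i ≤ e → (ρ.loc i x).core = (ρ.loc e x).core := by
  obtain ⟨log, hph, hlen, -, -, hu, -⟩ := h
  obtain ⟨f, hf, hmono⟩ := ρ.exists_read_times e x d log hph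
  have hlt : ∀ c < n * (r + 1) + 2, ∀ j < r + 2, c * (r + 2) + j < log.length := by
    intro c hc j hj
    refine lt_of_lt_of_le ?_ hlen
    calc c * (r + 2) + j < (c + 1) * (r + 2) := by rw [Nat.succ_mul]; omega
      _ ≤ logSize n r := Nat.mul_le_mul_right _ hc
  by_contra hcon
  push Not at hcon
  -- If the components never equal `s` during the scan, some component `j` differs from `s j` when
  -- collect `c` reads its last register, although collect `c + 1` reads `s j` there. So some
  -- process writes `s j` in between.
  have hbad : ∀ c : Fin (n * (r + 1) + 1), ∃ (jp : Fin (r + 1) × Fin n) (w : ℕ) (d' : D),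
      f (c * (r + 2) + (r + 1)) ≤ w ∧ w < f ((c + 1) * (r + 2) + (r + 1)) ∧
      ρ.ev w = some (.compute jp.2) ∧ (ρ.loc w jp.2).phase = .update d' ∧
      (ρ.loc w jp.2).entry d' = s jp.1 := by
    intro c
    have h1 := hf (c * (r + 2) + (r + 1)) (hlt c (by omega) _ (by omega))
    have : ∃ j : Fin (r + 1), ρ.reg (f (c * (r + 2) + (r + 1))) j.castSucc ≠ s j := by
      by_contra hall
      push Not at hall
      obtain ⟨i, hi1, hi2, hi3⟩ := hcon _ h1.1.le hall
      exact hi3 (h1.2.2 i hi1 hi2)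
    obtain ⟨j, hj⟩ := this
    have hl2 := hlt (c + 1) (by omega) j (by omega)
    have h2 := hf _ hl2
    have hread : ρ.reg (f ((c + 1) * (r + 2) + j)) j.castSucc = s j := by
      have h3 := hu (c + 1) (by omega) j
      rw [h2.2.1] at h3
      have hcast : (Fin.ofNat (r + 2) ((↑c + 1) * (r + 2) + ↑j)) = j.castSucc := by
        apply Fin.ext
        simp only [Fin.val_ofNat, Fin.val_castSucc]
        rw [Nat.mul_add_mod_of_lt (by omega)]
      rw [hcast] at h3
      exact Option.some.inj h3
    have hff : f (c * (r + 2) + (r + 1)) < f ((c + 1) * (r + 2) + j) :=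
      hmono _ _ (by rw [Nat.succ_mul]; omega) hl2
    obtain ⟨w, p, d', w1, w2, w3, w4, -, w5⟩ := ρ.exists_write hff hj hread
    refine ⟨(j, p), w, d', w1, w2.trans_le ?_, w3, w4, w5⟩
    have hj' := j.2
    rcases Nat.lt_or_ge j (r + 1) with hjr | hjr
    · exact (hmono _ _ (by omega) (hlt _ (by omega) _ (by omega))).le
    · omega
  choose g w d' hw1 hw2 hw3 hw4 hw5 using hbad
  -- There are `n * (r + 1) + 1` gaps between consecutive collects, but one pair of component and
  -- process fewer.
  have hnot : ¬ Function.Injective g := fun hinj => by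
    have := Fintype.card_le_of_injective g hinj
    simp only [Fintype.card_fin, Fintype.card_prod] at this
    rw [mul_comm] at this
    omega
  -- A pair repeated in two gaps would be a process that writes one entry twice, with the same
  -- counter `ts`.
  have key : ∀ c c' : Fin (n * (r + 1) + 1), c < c' → g c ≠ g c' := by
    intro c c' hcc hg
    have hww : w c < w c' := by
      refine (hw2 c).trans_le (le_trans ?_ (hw1 c'))
      rcases Nat.lt_or_ge (c + 1) c' with h | h
      · refine (hmono _ _ ?_ (hlt _ (by omega) _ (by omega))).le
        have := Nat.mul_lt_mul_of_pos_right h (show 0 < r + 2 by omega)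
        omega
      · have : (c' : ℕ) = c + 1 := by
          have : (c : ℕ) < c' := hcc
          omega
        rw [this]
    have hts : (ρ.loc (w c + 1) (g c).2).ts = (ρ.loc (w c) (g c).2).ts + 1 := by
      rw [ρ.loc_of_write (hw3 c) (hw4 c)]
    have hts' := ρ.ts_mono (g c).2 (Nat.succ_le_of_lt hww)
    have h1 := congrArg Entry.ts (hw5 c)
    have h2 := congrArg Entry.ts (hw5 c')
    rw [← hg] at h2
    simp only [Local.entry] at h1 h2
    simp only [Nat.succ_eq_add_one] at hts'
    omega
  apply hnot
  intro c c' hg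
  rcases lt_trichotomy c c' with h | h | h
  · exact absurd hg (key _ _ h)
  · exact h
  · exact absurd hg.symm (key _ _ h)

end Run

/-! ### Linearization of the scans -/

/-- The steps of a process whose scans are atomic; `s` are the current contents of the
components. -/
inductive AtomicMove (m b : ℕ) (s : Fin (r + 1) → Entry D) (a : Local D r) : Local D r → Prop
  | stay : AtomicMove m b s a a
  | invoke (v : D) (h : a.phase = .idle) : AtomicMove m b s a { a with phase := .update v }
  | write (d : D) (h : a.phase = .update d) :
      AtomicMove m b s a { a with ts := a.ts + 1, phase := .scan d [] }
  | conclude (d : D) (h : a.phase = .scan d []) (hle : ∀ j, (s j).hist.length ≤ a.hist.length) :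
      AtomicMove m b s a (a.conclude m b d fun j => (s j).key)
  | adopt (d v : D) (h : a.phase = .scan d []) : AtomicMove m b s a (a.finish v)
  | publish (d : D) (h : a.phase = .publish d) : AtomicMove m b s a { a with phase := .done d }
  | respond (d : D) (h : a.phase = .done d) : AtomicMove m b s a { a with phase := .idle }

/-- A run of the algorithm with atomic scans. Several processes may scan in one step; the scans
precede the write, if there is one in that step. -/
structure AtomicRun (D : Type u) (n m b r : ℕ) where
  reg : ℕ → Fin (r + 1) → Entry D
  st : ℕ → Fin n → Local D r
  move : ∀ i p, AtomicMove m b (reg i) (st i p) (st (i + 1) p)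
  write : ∀ i, reg (i + 1) = reg i ∨ ∃ p d, (st i p).phase = .update d ∧
    st (i + 1) p = { st i p with ts := (st i p).ts + 1, phase := .scan d [] } ∧
    reg (i + 1) = Function.update (reg i) (st i p).idx ((st i p).entry d)
  length_hist : ∀ i j t d, (reg i j).key = some (t, d) → (reg i j).hist.length = t

namespace Run

variable (ρ : Run D n m b r)

lemma Concludes.unique {ρ : Run D n m b r} {e : ℕ} {x : Fin n} {d d' : D}
    {s s' : Fin (r + 1) → Entry D}
    (h : ρ.Concludes e x d s) (h' : ρ.Concludes e x d' s') : d = d' ∧ s = s' := by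
  obtain ⟨log, h1, -, -, -, h2, -⟩ := h
  obtain ⟨log', h1', -, -, -, h2', -⟩ := h'
  rw [h1] at h1'
  cases h1'
  refine ⟨rfl, funext fun j => ?_⟩
  have := h2 0 (by omega) j
  rw [h2' 0 (by omega) j] at this
  exact (Option.some.inj this).symm

open Classical in
/-- The linearization point of the scan that process `x` completes at step `e`. -/
noncomputable def linPoint (x : Fin n) (e : ℕ) : ℕ :=
  if h : ∃ d s, ρ.Concludes e x d s then
    (ρ.exists_snapshot h.choose_spec.choose_spec).choose
  else 0

lemma linPoint_spec {e : ℕ} {x : Fin n} {d : D} {s : Fin (r + 1) → Entry D}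
    (h : ρ.Concludes e x d s) : ρ.linPoint x e ≤ e ∧
      (∀ j : Fin (r + 1), ρ.reg (ρ.linPoint x e) j.castSucc = s j) ∧
      ∀ i, ρ.linPoint x e ≤ i → i ≤ e → (ρ.loc i x).core = (ρ.loc e x).core := by
  have h' : ∃ d s, ρ.Concludes e x d s := ⟨d, s, h⟩
  have hs := (h'.choose_spec.choose_spec.unique h).2
  have := (ρ.exists_snapshot h'.choose_spec.choose_spec).choose_spec
  unfold linPoint
  rw [dif_pos h']
  exact ⟨this.1, fun j => (this.2.1 j).trans (congrFun hs j), this.2.2⟩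

/-- The scan that process `x` completes at step `e` is in progress in configuration `i`, and it was
linearized before. -/
def Linearized (i : ℕ) (x : Fin n) (e : ℕ) : Prop :=
  i ≤ e ∧ (∃ d s, ρ.Concludes e x d s) ∧ ρ.linPoint x e < i

lemma phase_of_linPoint_le {i e : ℕ} {x : Fin n} {d : D} {s : Fin (r + 1) → Entry D}
    (h : ρ.Concludes e x d s) (hi : ρ.linPoint x e ≤ i) (hie : i ≤ e) :
    ∃ log, (ρ.loc i x).phase = .scan d log := by
  have hc := (ρ.linPoint_spec h).2.2 i hi hie
  obtain ⟨log, h1, -⟩ := h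
  rw [core_of_scan h1] at hc
  exact core_phase_scan (congrArg Local.phase hc)

/-- From its linearization point to its end a scan keeps the process in the scan phase, and just
after the earlier conclusion, at `e + 1`, the process is not in that phase. -/
lemma lt_linPoint {e e' : ℕ} {x : Fin n} {d d' : D} {s s' : Fin (r + 1) → Entry D}
    (h : ρ.Concludes e x d s) (h' : ρ.Concludes e' x d' s') (hlt : e < e') :
    e + 1 < ρ.linPoint x e' := by
  by_contra hcon
  obtain ⟨log, hl⟩ := ρ.phase_of_linPoint_le h' (not_lt.1 hcon) hlt
  obtain ⟨-, -, -, -, -, -, h2⟩ := h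
  rw [h2] at hl
  exact conclude_phase_ne_scan _ _ _ _ _ hl

lemma Linearized.unique {ρ : Run D n m b r} {i e e' : ℕ} {x : Fin n} (h : ρ.Linearized i x e)
    (h' : ρ.Linearized i x e') : e = e' := by
  obtain ⟨h1, ⟨d, s, h2⟩, h3⟩ := h
  obtain ⟨h1', ⟨d', s', h2'⟩, h3'⟩ := h'
  rcases lt_trichotomy e e' with hlt | hlt | hlt
  · have := ρ.lt_linPoint h2 h2' hlt; omega
  · exact hlt
  · have := ρ.lt_linPoint h2' h2 hlt; omega

open Classical in
/-- The configuration that determines the state of `x` in configuration `i` when scans are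
atomic. -/
noncomputable def ahead (x : Fin n) (i : ℕ) : ℕ :=
  if h : ∃ e, ρ.Linearized i x e then h.choose + 1 else i

lemma ahead_of_linearized {i e : ℕ} {x : Fin n} (h : ρ.Linearized i x e) :
    ρ.ahead x i = e + 1 := by
  have h' : ∃ e, ρ.Linearized i x e := ⟨e, h⟩
  unfold ahead
  rw [dif_pos h', h'.choose_spec.unique h]

lemma ahead_of_not_linearized {i : ℕ} {x : Fin n} (h : ∀ e, ¬ ρ.Linearized i x e) :
    ρ.ahead x i = i :=
  dif_neg (not_exists.2 h)

lemma le_ahead (x : Fin n) (i : ℕ) : i ≤ ρ.ahead x i := by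
  by_cases h : ∃ e, ρ.Linearized i x e
  · obtain ⟨e, he⟩ := h
    rw [ρ.ahead_of_linearized he]
    exact he.1.trans (Nat.le_succ e)
  · rw [ρ.ahead_of_not_linearized (not_exists.1 h)]

lemma ahead_of_phase {i : ℕ} {x : Fin n} (h : ∀ d log, (ρ.loc i x).phase ≠ .scan d log) :
    ρ.ahead x i = i := by
  refine ρ.ahead_of_not_linearized ?_
  rintro e ⟨h1, ⟨d, s, h2⟩, h3⟩
  obtain ⟨log, hl⟩ := ρ.phase_of_linPoint_le h2 h3.le h1
  exact h _ _ hl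

/-- The state of `x` in configuration `i` when scans are atomic. -/
noncomputable def atomicState (i : ℕ) (x : Fin n) : Local D r := (ρ.loc (ρ.ahead x i) x).core

lemma atomicState_of_phase {i : ℕ} {x : Fin n} (h : ∀ d log, (ρ.loc i x).phase ≠ .scan d log) :
    ρ.atomicState i x = ρ.loc i x := by
  rw [atomicState, ρ.ahead_of_phase h, core_eq_self h]

/-- The whole effect of a concluding scan is moved to its linearization point: there the process
still scans, and one configuration later it is already in the state that it really reaches at `e +
1`. -/
lemma atomicState_concludes {e : ℕ} {x : Fin n} {d : D} {s : Fin (r + 1) → Entry D}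
    (h : ρ.Concludes e x d s) :
    ρ.atomicState (ρ.linPoint x e) x = { ρ.loc e x with phase := .scan d [] } ∧
    ρ.atomicState (ρ.linPoint x e + 1) x = ρ.loc (e + 1) x := by
  obtain ⟨h1, h2, h3⟩ := ρ.linPoint_spec h
  have hns : ∀ d log, (ρ.loc (e + 1) x).phase ≠ .scan d log := by
    intro d' log' hl
    obtain ⟨-, -, -, -, -, -, h4⟩ := h
    rw [h4] at hl
    exact conclude_phase_ne_scan _ _ _ _ _ hl
  constructor
  · have : ρ.ahead x (ρ.linPoint x e) = ρ.linPoint x e := by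
      refine ρ.ahead_of_not_linearized ?_
      rintro e' ⟨h1', ⟨d', s', h2'⟩, h3'⟩
      rcases lt_trichotomy e e' with hlt | rfl | hlt
      · have := ρ.lt_linPoint h h2' hlt; omega
      · omega
      · have := ρ.lt_linPoint h2' h hlt; omega
    obtain ⟨log, hph, -⟩ := h
    rw [atomicState, this, h3 _ le_rfl h1, core_of_scan hph]
  · rw [← core_eq_self hns]
    rcases h1.lt_or_eq with hlt | heq
    · rw [atomicState, ρ.ahead_of_linearized ⟨hlt, ⟨d, s, h⟩, Nat.lt_succ_self _⟩]
    · rw [atomicState, heq, ρ.ahead_of_phase hns]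

/-- A longer history would contain an output of the current operation, and adoption takes precedence
over concluding. -/
lemma length_hist_le_of_concludes {e : ℕ} {x : Fin n} {d : D} {s : Fin (r + 1) → Entry D}
    (h : ρ.Concludes e x d s) (j : Fin (r + 1)) :
    (s j).hist.length ≤ (ρ.loc e x).hist.length := by
  obtain ⟨log, -, -, -, hA, hu, -⟩ := h
  by_contra hlt
  rw [not_le] at hlt
  exact hA ((s j).hist[(ρ.loc e x).hist.length]) ⟨s j, hu.mem j, List.getElem?_eq_getElem hlt⟩

lemma atomicMove_of_concludes {e : ℕ} {x : Fin n} {d : D} {s : Fin (r + 1) → Entry D}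
    (h : ρ.Concludes e x d s) :
    AtomicMove m b (fun j : Fin (r + 1) => ρ.reg (ρ.linPoint x e) j.castSucc)
      (ρ.atomicState (ρ.linPoint x e) x) (ρ.atomicState (ρ.linPoint x e + 1) x) := by
  obtain ⟨h1, h2⟩ := ρ.atomicState_concludes h
  have h3 := (ρ.linPoint_spec h).2.1
  have hle := ρ.length_hist_le_of_concludes h
  obtain ⟨log, -, -, -, -, -, h4⟩ := h
  rw [h1, h2, h4]
  have : (fun j : Fin (r + 1) => ρ.reg (ρ.linPoint x e) j.castSucc) = s := funext h3
  rw [this]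
  exact AtomicMove.conclude (a := { ρ.loc e x with phase := .scan d [] }) d rfl hle

/-- A linearization point yields an atomic scan. From there to the real end of that scan the atomic
state stands still. Elsewhere it follows the run, where reads and failed evaluations are invisible.
-/
lemma atomicMove (i : ℕ) (x : Fin n) :
    AtomicMove m b (fun j : Fin (r + 1) => ρ.reg i j.castSucc)
      (ρ.atomicState i x) (ρ.atomicState (i + 1) x) := by
  by_cases hlin : ∃ e d s, ρ.Concludes e x d s ∧ ρ.linPoint x e = i
  · obtain ⟨e, d, s, h, rfl⟩ := hlin
    exact ρ.atomicMove_of_concludes h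
  by_cases hi : ∃ e, ρ.Linearized i x e
  · obtain ⟨e, he⟩ := hi
    have : ρ.atomicState (i + 1) x = ρ.atomicState i x := by
      rw [atomicState, atomicState, ρ.ahead_of_linearized he]
      obtain ⟨h1, ⟨d, s, h2⟩, h3⟩ := he
      rcases h1.lt_or_eq with hlt | rfl
      · rw [ρ.ahead_of_linearized ⟨hlt, ⟨d, s, h2⟩, by omega⟩]
      · rw [ρ.ahead_of_phase]
        obtain ⟨-, -, -, -, -, -, h4⟩ := h2
        rw [h4]
        exact conclude_phase_ne_scan _ _ _
    rw [this]
    exact .stay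
  rw [not_exists] at hi
  have hi' : ∀ e, ¬ ρ.Linearized (i + 1) x e := by
    rintro e ⟨h1, ⟨d, s, h2⟩, h3⟩
    rcases (Nat.lt_succ_iff.1 h3).lt_or_eq with h | h
    · exact hi e ⟨by omega, ⟨d, s, h2⟩, h⟩
    · exact hlin ⟨e, d, s, h2, h⟩
  rw [atomicState, atomicState, ρ.ahead_of_not_linearized hi, ρ.ahead_of_not_linearized hi']
  rcases ρ.local_step i x with ⟨-, h⟩ | ⟨e, he, -, h⟩
  · rw [h]; exact .stay
  generalize hl' : ρ.loc (i + 1) x = l' at h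
  cases h with
  | invoke v h =>
    rw [core_eq_self (l := ρ.loc i x) (by simp [h])]
    exact .invoke v h
  | write d h =>
    rw [core_eq_self (l := ρ.loc i x) (by simp [h])]
    exact .write d h
  | read d log h hlt =>
    rw [core_of_scan h]
    exact .stay
  | eval d log h hge =>
    rcases eval_cases (n := n) (m := m) (b := b) (ρ.loc i x) d log with
      ⟨v, -, hv⟩ | ⟨hA, s, hs, hv⟩ | ⟨-, -, hv⟩
    · rw [hv]
      exact .adopt (a := (ρ.loc i x).core) d v (by rw [core_of_scan h])
    · have hc : ρ.Concludes i x d s := ⟨log, h, hge, he, hA, hs, hl'.trans hv⟩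
      have := (ρ.linPoint_spec hc).1
      rcases this.lt_or_eq with hlt | heq
      · exact absurd ⟨le_rfl, ⟨d, s, hc⟩, hlt⟩ (hi i)
      · exact absurd ⟨i, d, s, hc, heq⟩ hlin
    · rw [hv, core_of_scan h]
      exact .stay
  | publish d h =>
    rw [core_eq_self (l := ρ.loc i x) (by simp [h])]
    exact .publish d h
  | respond d h =>
    rw [core_eq_self (l := ρ.loc i x) (by simp [h])]
    exact .respond d h

lemma atomicState_of_write {i : ℕ} {p : Fin n} {d : D} (he : ρ.ev i = some (.compute p))
    (hp : (ρ.loc i p).phase = .update d) : ρ.atomicState i p = ρ.loc i p ∧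
      ρ.atomicState (i + 1) p = ρ.loc (i + 1) p := by
  have h1 : ∀ d log, (ρ.loc i p).phase ≠ .scan d log := by simp [hp]
  refine ⟨ρ.atomicState_of_phase h1, ?_⟩
  have hl := ρ.loc_of_write he hp
  have : ρ.ahead p (i + 1) = i + 1 := by
    refine ρ.ahead_of_not_linearized ?_
    rintro e ⟨h2, ⟨d, s, h3⟩, h4⟩
    obtain ⟨log, hl⟩ := ρ.phase_of_linPoint_le h3 (Nat.lt_succ_iff.1 h4) (by omega)
    exact h1 _ _ hl
  rw [atomicState, this, hl]
  rfl

/-- The run with atomic scans that corresponds to a run. -/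
noncomputable def atomic : AtomicRun D n m b r where
  reg i j := ρ.reg i j.castSucc
  st := ρ.atomicState
  move := ρ.atomicMove
  write i := by
    rcases ρ.reg_step i with h | ⟨p, d, he, hp, h⟩ | ⟨p, d, he, hp, h⟩
    · left; rw [h]
    · right
      obtain ⟨h1, h2⟩ := ρ.atomicState_of_write he hp
      refine ⟨p, d, by rw [h1, hp], by rw [h1, h2, ρ.loc_of_write he hp], ?_⟩
      rw [h1, h]
      funext j
      simp [Function.update_apply]
    · left
      rw [h]
      funext j
      exact Function.update_of_ne (Fin.castSucc_lt_last j).ne _ _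
  length_hist i j t d h := ρ.length_hist_of_key h

end Run

/-! ### Agreement -/

/-- If all but `b` components hold one of at most `m` values, one of these values is preferred
after the scan. -/
lemma newPref_mem (hr : r = (m + 1) * b) {κ : Fin (r + 1) → Option (ℕ × D)} {t : ℕ}
    {V : Finset D} (hV : V.card ≤ m) {B : Finset (Fin (r + 1))} (hB : B.card ≤ b)
    (hκ : ∀ j ∉ B, ∃ v ∈ V, κ j = some (t, v)) (d : D) : newPref b κ t d ∈ V := by
  classical
  have hcard : (Finset.univ \ B).card + B.card = r + 1 := by
    rw [Finset.card_sdiff_add_card_eq_card (Finset.subset_univ _), Finset.card_univ,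
      Fintype.card_fin]
  rcases newPref_cases b κ t d with h | ⟨-, h⟩
  -- A value outside `V` occurs only inside `B`, hence at most `b` times.
  · by_contra hn
    have : (Finset.univ.filter fun j => κ j = some (t, newPref b κ t d)) ⊆ B := by
      intro j hj
      by_contra hjB
      obtain ⟨v, hv, hvj⟩ := hκ j hjB
      rw [(Finset.mem_filter.1 hj).2] at hvj
      cases hvj
      exact hn hv
    have h2 := Finset.card_le_card this
    unfold count at h
    have h3 : (Finset.univ.filter fun j => κ j = some (t, newPref b κ t d)).card ≤ b :=
      h2.trans hB
    convert lt_irrefl _ (h.trans_le (le_trans (le_of_eq (by congr)) h3))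
  · exfalso
    -- If no value occurred more than `b` times, those in `V` would fill at most `m * b` components,
    -- but at least `m * b + 1` lie outside `B`.
    have hsub : Finset.univ \ B ⊆
        V.biUnion fun v => Finset.univ.filter fun j => κ j = some (t, v) := by
      intro j hj
      obtain ⟨v, hv, hvj⟩ := hκ j (Finset.mem_sdiff.1 hj).2
      exact Finset.mem_biUnion.2 ⟨v, hv, by simpa using hvj⟩
    have h1 := (Finset.card_le_card hsub).trans
      (Finset.card_biUnion_le_card_mul _ _ b fun v _ => by
        have := not_lt.1 (h v)
        unfold count at this
        convert this)
    have h2 : V.card * b ≤ m * b := Nat.mul_le_mul_right _ hV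
    rw [Nat.succ_mul] at hr
    omega

/-- Serves to select the earliest deciders, with ties broken arbitrarily. -/
lemma exists_subset_minimal {α : Type*} [DecidableEq α] (f : α → ℕ) (S : Finset α) (c : ℕ)
    (hc : c ≤ S.card) :
    ∃ F ⊆ S, F.card = c ∧ ∀ x ∈ F, ∀ y ∈ S, y ∉ F → f x ≤ f y := by
  induction c with
  | zero => exact ⟨∅, by simp, by simp, by simp⟩
  | succ c ih =>
    obtain ⟨F, hFS, hFc, hF⟩ := ih (by omega)
    have hne : (S \ F).Nonempty := by
      rw [← Finset.card_pos, Finset.card_sdiff_of_subset hFS]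
      omega
    obtain ⟨z, hz, hmin⟩ := Finset.exists_min_image (S \ F) f hne
    rw [Finset.mem_sdiff] at hz
    refine ⟨insert z F, Finset.insert_subset hz.1 hFS,
      by rw [Finset.card_insert_of_notMem hz.2, hFc], fun x hx y hy hyF => ?_⟩
    rw [Finset.mem_insert, not_or] at hyF
    rcases Finset.mem_insert.1 hx with rfl | hx
    · exact hmin y (Finset.mem_sdiff.2 ⟨hy, hyF.2⟩)
    · exact hF x hx y hy hyF.2

lemma hist_length_le_conclude (l : Local D r) (d : D) (κ : Fin (r + 1) → Option (ℕ × D)) :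
    l.hist.length ≤ (l.conclude m b d κ).hist.length := by
  rcases conclude_cases (m := m) (b := b) l d κ with ⟨-, h⟩ | ⟨-, h⟩ <;> rw [h]
  simp [Local.finish]

namespace AtomicRun

variable (μ : AtomicRun D n m b r)

/-- In step `i`, process `p` decides `v` in its operation number `t + 1`. -/
def Decides (i : ℕ) (p : Fin n) (t : ℕ) (v : D) : Prop :=
  ∃ d, (μ.st i p).phase = .scan d [] ∧ (μ.st i p).hist.length = t ∧
    Decisive m (fun j => (μ.reg i j).key) t ∧ newPref b (fun j => (μ.reg i j).key) t d = v ∧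
    μ.st (i + 1) p = (μ.st i p).finish v

lemma hist_length_mono (p : Fin n) : Monotone fun i => (μ.st i p).hist.length := by
  refine monotone_nat_of_le_succ fun i => ?_
  have h := μ.move i p
  generalize μ.st (i + 1) p = l' at h ⊢
  cases h with
  | conclude d h hle => exact hist_length_le_conclude _ _ _
  | adopt d v h => simp [Local.finish]
  | _ => rfl

lemma Decides.hist_length {μ : AtomicRun D n m b r} {i i' : ℕ} {p : Fin n} {t : ℕ} {v : D}
    (h : μ.Decides i p t v) (hi : i < i') : t < (μ.st i' p).hist.length := by
  obtain ⟨d, -, h2, -, -, h3⟩ := h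
  refine lt_of_lt_of_le ?_ (μ.hist_length_mono p (Nat.succ_le_of_lt hi))
  simp only [Nat.succ_eq_add_one, h3, Local.finish, List.length_append, List.length_singleton, h2]
  omega

lemma Decides.unique {μ : AtomicRun D n m b r} {i i' : ℕ} {p : Fin n} {t : ℕ} {v v' : D}
    (h : μ.Decides i p t v) (h' : μ.Decides i' p t v') : i = i' ∧ v = v' := by
  have hi : i = i' := by
    rcases lt_trichotomy i i' with hlt | hlt | hlt
    · have h1 := h.hist_length hlt
      obtain ⟨d, -, h2, -⟩ := h'
      omega
    · exact hlt
    · have h1 := h'.hist_length hlt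
      obtain ⟨d, -, h2, -⟩ := h
      omega
  subst hi
  obtain ⟨d, h1, -, -, h2, -⟩ := h
  obtain ⟨d', h1', -, -, h2', -⟩ := h'
  rw [h1] at h1'
  cases h1'
  exact ⟨rfl, h2.symm.trans h2'⟩

/-- A key that belongs to an operation after the first `t + 1`, or to operation `t + 1` and has a
value in `V`. -/
def GoodKey (t : ℕ) (V : Finset D) (o : Option (ℕ × D)) : Prop :=
  ∃ t' v, o = some (t', v) ∧ (t < t' ∨ t' = t ∧ v ∈ V)

/-- The process has completed more than `t` operations, or `t` and prefers a value in `V`. -/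
def GoodState (t : ℕ) (V : Finset D) (a : Local D r) : Prop :=
  t < a.hist.length ∨
    a.hist.length = t ∧ ∃ v ∈ V, a.phase = .update v ∨ a.phase = .scan v []

-- The bound on the histories excludes good keys of later operations, so that the good keys all
-- carry values of `V`.
variable {μ} in
lemma newPref_mem_of_goodKey (hr : r = (m + 1) * b) {i t : ℕ} {V : Finset D} (hV : V.card ≤ m)
    {B : Finset (Fin (r + 1))} (hB : B.card ≤ b)
    (hκ : ∀ j, GoodKey t V (μ.reg i j).key ∨ j ∈ B) (hle : ∀ j, (μ.reg i j).hist.length ≤ t)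
    (d : D) : newPref b (fun j => (μ.reg i j).key) t d ∈ V := by
  refine newPref_mem hr hV hB (fun j hj => ?_) d
  obtain ⟨t', v, h1, h2⟩ := (hκ j).resolve_right hj
  have := hle j
  rw [μ.length_hist i j t' v h1] at this
  rcases h2 with h2 | ⟨rfl, h2⟩
  · omega
  · exact ⟨v, h2, h1⟩

/-- After a scan that saw only the values of `V` in operation `t + 1`, all processes outside a set
`F` of processes that have decided write other values to one component only. -/
lemma good_of_decisive (hr : r = (m + 1) * b) {i₀ t : ℕ} {V : Finset D} (hV : V.card ≤ m)
    (hκ : ∀ j, ∃ v ∈ V, (μ.reg i₀ j).key = some (t, v)) {F : Finset (Fin n)}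
    (hF : Fᶜ.card ≤ b) (hF' : ∀ p ∈ F, t < (μ.st (i₀ + 1) p).hist.length) (i : ℕ) (hi : i₀ < i) :
    (∀ j, GoodKey t V (μ.reg i j).key ∨ j ∈ Fᶜ.image fun p => (μ.st (i₀ + 1) p).idx) ∧
    ∀ p, GoodState t V (μ.st i p) ∨ (p ∉ F ∧ (μ.st i p).idx = (μ.st (i₀ + 1) p).idx) := by
  classical
  induction i, hi using Nat.le_induction with
  | base =>
    constructor
    · have hg : ∀ j, GoodKey t V (μ.reg i₀ j).key := fun j => by
        obtain ⟨v, hv, h⟩ := hκ j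
        exact ⟨t, v, h, .inr ⟨rfl, hv⟩⟩
      intro j
      rcases μ.write i₀ with h | ⟨p, d, hp, hp', h⟩
      · rw [Nat.succ_eq_add_one, h]; exact .inl (hg j)
      · rw [Nat.succ_eq_add_one, h, Function.update_apply]
        split_ifs with hj
        -- The write in step `i₀` follows the scan. A process of `F` has already decided and writes
        -- a later key; any other process hits the single component charged to it, since writing
        -- does not advance `idx`.
        · by_cases hpF : p ∈ F
          · left
            refine ⟨_, d, rfl, .inl ?_⟩
            have := hF' p hpF
            rwa [hp'] at this
          · right
            exact Finset.mem_image.2 ⟨p, by simpa using hpF, by rw [hp', hj]⟩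
        · exact .inl (hg j)
    · intro p
      by_cases hpF : p ∈ F
      · exact .inl (.inl (hF' p hpF))
      · exact .inr ⟨hpF, rfl⟩
  | succ i hi ih =>
    obtain ⟨ihr, ihp⟩ := ih
    constructor
    · intro j
      rcases μ.write i with h | ⟨p, d, hp, hp', h⟩
      · rw [h]; exact ihr j
      · rw [h, Function.update_apply]
        split_ifs with hj
        · rcases ihp p with (hg | ⟨hg, v, hv, hpv⟩) | ⟨hpF, hidx⟩
          · exact .inl ⟨_, d, rfl, .inl hg⟩
          · rw [hp] at hpv
            rcases hpv with hpv | hpv <;> cases hpv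
            exact .inl ⟨_, d, rfl, .inr ⟨hg, hv⟩⟩
          · right
            exact Finset.mem_image.2 ⟨p, by simpa using hpF, by rw [hj, hidx]⟩
        · exact ihr j
    · intro p
      have h := μ.move i p
      have ih := ihp p
      have hB : (Fᶜ.image fun p => (μ.st (i₀ + 1) p).idx).card ≤ b :=
        Finset.card_image_le.trans hF
      generalize hst : μ.st (i + 1) p = l' at h ⊢
      cases h with
      | stay => exact ih
      | invoke v h =>
        rcases ih with (hg | ⟨hg, v, hv, hpv⟩) | hg
        · exact .inl (.inl hg)
        · rw [h] at hpv
          rcases hpv with hpv | hpv <;> cases hpv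
        · exact .inr hg
      | write d h =>
        rcases ih with (hg | ⟨hg, v, hv, hpv⟩) | hg
        · exact .inl (.inl hg)
        · rw [h] at hpv
          rcases hpv with hpv | hpv <;> cases hpv
          exact .inl (.inr ⟨hg, d, hv, .inr rfl⟩)
        · exact .inr hg
      | conclude d h hle =>
        left
        by_cases hlt : t < (μ.st i p).hist.length
        · exact .inl (hlt.trans_le (hist_length_le_conclude _ _ _))
        -- Fewer than `r + 1` components are charged, so the scan sees a good one, whose history has
        -- length at least `t`. As a concluding scan sees no history longer than its own, the
        -- process cannot be in an earlier operation.
        have hex : ∃ j, j ∉ Fᶜ.image fun p => (μ.st (i₀ + 1) p).idx := by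
          by_contra hall
          push Not at hall
          have := Finset.card_le_card (Finset.subset_iff.2 fun j _ => hall j :
            (Finset.univ : Finset (Fin (r + 1))) ⊆ _)
          rw [Finset.card_univ, Fintype.card_fin] at this
          rw [Nat.succ_mul] at hr
          omega
        obtain ⟨j, hj⟩ := hex
        obtain ⟨t', v, h1, h2⟩ := (ihr j).resolve_right hj
        have h3 := μ.length_hist i j t' v h1
        have h4 := hle j
        have hlen : (μ.st i p).hist.length = t := by
          rcases h2 with h2 | ⟨h2, -⟩ <;> omega
        have hmem := newPref_mem_of_goodKey hr hV hB ihr (fun j => hlen ▸ hle j) d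
        rcases conclude_cases (m := m) (b := b) (μ.st i p) d (fun j => (μ.reg i j).key) with
          ⟨-, h⟩ | ⟨-, h⟩ <;> rw [h, hlen]
        · exact .inl (by simp [Local.finish, hlen])
        · exact .inr ⟨hlen, _, hmem, .inl rfl⟩
      | adopt d v h =>
        rcases ih with (hg | ⟨hg, -⟩) | hg
        · exact .inl (.inl (by simp [Local.finish]; omega))
        · exact .inl (.inl (by simp [Local.finish]; omega))
        · exact .inr hg
      | publish d h =>
        rcases ih with (hg | ⟨hg, v, hv, hpv⟩) | hg
        · exact .inl (.inl hg)
        · rw [h] at hpv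
          rcases hpv with hpv | hpv <;> cases hpv
        · exact .inr hg
      | respond d h =>
        rcases ih with (hg | ⟨hg, v, hv, hpv⟩) | hg
        · exact .inl (.inl hg)
        · rw [h] at hpv
          rcases hpv with hpv | hpv <;> cases hpv
        · exact .inr hg

theorem encard_decided_le (hr : r = (m + 1) * b) {k : ℕ} (hb : b + k + 1 = n + m)
    (hmk : m ≤ k) (t : ℕ) : {v | ∃ i p, μ.Decides i p t v}.encard ≤ k := by
  classical
  rcases isEmpty_or_nonempty D with hD | hD
  · rw [Set.eq_empty_of_isEmpty {v | ∃ i p, μ.Decides i p t v}]; simp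
  set S : Finset (Fin n) := Finset.univ.filter fun p => ∃ i v, μ.Decides i p t v with hS
  have hex : ∀ p, ∃ i v, p ∈ S → μ.Decides i p t v := by
    intro p
    by_cases hp : p ∈ S
    · obtain ⟨i, v, h⟩ := (Finset.mem_filter.1 hp).2
      exact ⟨i, v, fun _ => h⟩
    · exact ⟨0, Classical.arbitrary D, fun h => absurd h hp⟩
  choose T val hT using hex
  have hmemS : ∀ {i p v}, μ.Decides i p t v → p ∈ S := fun {i p v} h =>
    Finset.mem_filter.2 ⟨Finset.mem_univ _, i, v, h⟩
  suffices ∃ W : Finset D, W.card ≤ k ∧ ∀ p ∈ S, val p ∈ W by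
    obtain ⟨W, hW, hSW⟩ := this
    refine le_trans (Set.encard_le_encard (t := (W : Set D)) ?_) ?_
    · rintro v ⟨i, p, h⟩
      have hp := hmemS h
      rw [((hT p hp).unique h).2.symm]
      exact hSW p hp
    · rw [Set.encard_coe_eq_coe_finsetCard]
      exact_mod_cast hW
  by_cases hk : S.card ≤ k
  · exact ⟨S.image val, Finset.card_image_le.trans hk, fun p hp => Finset.mem_image_of_mem _ hp⟩
  -- This size leaves exactly `b` processes outside `F`, and `k - m` values for the deciders in `F`
  -- other than the last one.
  obtain ⟨F, hFS, hFc, hF⟩ := exists_subset_minimal T S (k - m + 1) (by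
    have : S.card ≤ n := by simpa using Finset.card_le_univ S
    rcases Nat.eq_zero_or_pos m with rfl | hm <;> omega)
  obtain ⟨q, hq, hmax⟩ := Finset.exists_max_image F T (Finset.card_pos.1 (by omega))
  obtain ⟨d, hq1, hq2, hq3, hq4, hq5⟩ := hT q (hFS hq)
  -- The default value is never used, since a decisive scan has no empty key.
  set V : Finset D := (Finset.univ.image fun j => (μ.reg (T q) j).key).image
    fun o => o.elim (Classical.arbitrary D) Prod.snd with hVdef
  have hV : V.card ≤ m := by
    refine Finset.card_image_le.trans ?_
    convert hq3.2
  have hκ : ∀ j, ∃ v ∈ V, (μ.reg (T q) j).key = some (t, v) := fun j => by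
    obtain ⟨v, hv⟩ := hq3.1 j
    exact ⟨v, Finset.mem_image.2 ⟨some (t, v), Finset.mem_image.2 ⟨j, Finset.mem_univ _, hv⟩,
      rfl⟩, hv⟩
  have hFcompl : Fᶜ.card ≤ b := by
    rw [Finset.card_compl, Fintype.card_fin]
    omega
  refine ⟨(F.erase q).image val ∪ V, ?_, fun p hp => ?_⟩
  · have h1 := Finset.card_union_le ((F.erase q).image val) V
    have h2 : ((F.erase q).image val).card ≤ (F.erase q).card := Finset.card_image_le
    rw [Finset.card_erase_of_mem hq, hFc] at h2
    omega
  · rw [Finset.mem_union]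
    by_cases hpF : p ∈ F.erase q
    · exact .inl (Finset.mem_image_of_mem _ hpF)
    right
    have hle : T q ≤ T p := by
      by_cases hpq : p = q
      · rw [hpq]
      · exact hF q hq p hp fun h => hpF (Finset.mem_erase.2 ⟨hpq, h⟩)
    obtain ⟨d', h1, h2, h3, h4, h5⟩ := hT p hp
    have hlen : ∀ j, (μ.reg (T p) j).hist.length ≤ t := fun j => by
      obtain ⟨v, hv⟩ := h3.1 j
      exact (μ.length_hist _ _ _ _ hv).le
    rw [← h4]
    -- Decisions may fall into the same step; then both scans return the same vector and no
    -- component is spoiled.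
    rcases hle.lt_or_eq with hlt | heq
    · exact newPref_mem_of_goodKey hr hV (Finset.card_image_le.trans hFcompl)
        (μ.good_of_decisive hr hV hκ hFcompl (fun x hx => (hT x (hFS hx)).hist_length
          (Nat.lt_succ_of_le (hmax x hx))) (T p) hlt).1 hlen d'
    · refine newPref_mem hr hV (B := ∅) (by simp) (fun j _ => ?_) d'
      rw [← heq]
      exact hκ j

end AtomicRun

namespace Run

variable (ρ : Run D n m b r)

lemma decides_of_concludes {e : ℕ} {x : Fin n} {d : D} {s : Fin (r + 1) → Entry D}
    (h : ρ.Concludes e x d s) (hD : Decisive m (fun j => (s j).key) (ρ.loc e x).hist.length) :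
    ρ.atomic.Decides (ρ.linPoint x e) x (ρ.loc e x).hist.length
      (newPref b (fun j => (s j).key) (ρ.loc e x).hist.length d) := by
  obtain ⟨h1, h2⟩ := ρ.atomicState_concludes h
  have h3 : (fun j : Fin (r + 1) => ρ.reg (ρ.linPoint x e) j.castSucc) = s :=
    funext (ρ.linPoint_spec h).2.1
  obtain ⟨log, -, -, -, -, -, h4⟩ := h
  subst h3
  refine ⟨d, ?_, ?_, hD, rfl, ?_⟩
  · simp [atomic, h1]
  · simp [atomic, h1]
  · change ρ.atomicState _ _ = Local.finish (ρ.atomicState _ _) _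
    rw [h1, h2, h4]
    rcases conclude_cases (m := m) (b := b) (ρ.loc e x) d
      (fun j => (ρ.reg (ρ.linPoint x e) j.castSucc).key) with ⟨-, h⟩ | ⟨h, -⟩
    · rw [h]; rfl
    · exact absurd hD h

end Run

theorem kAgreement (hr : r = (m + 1) * b) {k : ℕ} (hb : b + k + 1 = n + m) (hmk : m ≤ k) :
    KAgreement (algorithm D n m b r) n k := by
  intro α t
  refine le_trans (Set.encard_le_encard ?_)
    ((Run.ofExecution α).atomic.encard_decided_le hr hb hmk (t - 1))
  rintro d ⟨p, i, hi, rfl⟩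
  rw [← Run.ofExecution_ev_eq] at hi
  have hs := ((Run.ofExecution α).sound
    (P := fun t v => ∃ i p, (Run.ofExecution α).atomic.Decides i p t v) (Q := fun _ _ => True)
    (fun _ _ _ _ => trivial)
    (fun e x d s h hD _ => ⟨_, x, (Run.ofExecution α).decides_of_concludes h hD⟩) i).2 p
  obtain ⟨t, ht, hd⟩ := Run.respond_mem _ hs hi
  rw [Run.invocations_of_respond α hi, ht]
  exact hd

/-! ### Combinatorial core of progress -/

open Classical in
lemma count_update_le (κ : Fin (r + 1) → Option (ℕ × D)) (t : ℕ) (d : D) (j : Fin (r + 1))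
    (o : Option (ℕ × D)) : count (Function.update κ j o) t d ≤ count κ t d + 1 := by
  unfold count
  refine (Finset.card_le_card (t := insert j (Finset.univ.filter fun j => κ j = some (t, d)))
    fun j' hj' => ?_).trans (Finset.card_insert_le _ _)
  by_cases h : j' = j
  · simp [h]
  · simpa [h, Function.update_of_ne h] using hj'

open Classical in
lemma count_update_le_of_ne (κ : Fin (r + 1) → Option (ℕ × D)) {t : ℕ} {d : D} (j : Fin (r + 1))
    {o : Option (ℕ × D)} (ho : o ≠ some (t, d)) :
    count (Function.update κ j o) t d ≤ count κ t d := by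
  unfold count
  refine Finset.card_le_card fun j' hj' => ?_
  by_cases h : j' = j
  · subst h; simp [ho] at hj'
  · simpa [h, Function.update_of_ne h] using hj'

open Classical in
lemma sum_count_le (κ : Fin (r + 1) → Option (ℕ × D)) (t : ℕ) (S : Finset D) :
    ∑ d ∈ S, count κ t d ≤ r + 1 := by
  unfold count
  rw [← Finset.card_biUnion]
  · simpa using Finset.card_le_univ
      (S.biUnion fun d => Finset.univ.filter fun j => κ j = some (t, d))
  · intro d _ d' _ hdd
    rw [Function.onFun, Finset.disjoint_left]
    intro j hj hj'
    rw [Finset.mem_filter] at hj hj'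
    rw [hj.2] at hj'
    simp only [Option.some.injEq, Prod.mk.injEq] at hj'
    exact hdd hj'.2.2

/-- As soon as some value is held by more than `b` components, a scan selects only such values. -/
lemma newPref_ne {κ : Fin (r + 1) → Option (ℕ × D)} {t : ℕ} {d : D}
    (h : ∃ v, b < count κ t v) (hd : count κ t d ≤ b) (d' : D) : newPref b κ t d' ≠ d := by
  rintro rfl
  obtain ⟨v, hv⟩ := h
  rcases newPref_cases b κ t d' with h | ⟨-, h⟩
  · omega
  · exact h v hv

open Classical in
/-- The values that can still spread: preferences, and values held by more than `b` components. -/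
noncomputable def liveValues (b : ℕ) (P : Finset (Fin n)) (κ : Fin (r + 1) → Option (ℕ × D))
    (t : ℕ) (pref : Fin n → D) : Finset D :=
  P.image pref ∪
    (Finset.univ.biUnion fun j => (κ j).toFinset.image Prod.snd).filter fun d => b < count κ t d

lemma mem_liveValues {P : Finset (Fin n)} {κ : Fin (r + 1) → Option (ℕ × D)} {t : ℕ}
    {pref : Fin n → D} {d : D} :
    d ∈ liveValues b P κ t pref ↔ (∃ x ∈ P, pref x = d) ∨ b < count κ t d := by
  classical
  unfold liveValues
  rw [Finset.mem_union, Finset.mem_image, Finset.mem_filter]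
  refine or_congr Iff.rfl ⟨fun h => h.2, fun h => ⟨?_, h⟩⟩
  obtain ⟨j, hj⟩ := exists_key_of_count_pos (Nat.zero_lt_of_lt h)
  exact Finset.mem_biUnion.2 ⟨j, Finset.mem_univ _, Finset.mem_image.2 ⟨(t, d), by simp [hj], rfl⟩⟩

lemma exists_eventually_forall {α : Type*} [Finite α] {Q : α → ℕ → Prop}
    (h : ∀ a, ∃ N, ∀ i ≥ N, Q a i) : ∃ N, ∀ i ≥ N, ∀ a, Q a i := by
  have := Filter.eventually_all.2 fun a => Filter.eventually_atTop.2 (h a)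
  exact Filter.eventually_atTop.1 this

/-- At most `m` processes that run the update-scan loop of operation `t + 1`, while only they write
values of this operation, cannot continue forever without a scan that permits a decision. -/
theorem not_forever_indecisive (hr : r = (m + 1) * b) {P : Finset (Fin n)} (hP : P.Nonempty)
    (hPm : P.card ≤ m) {κ : ℕ → Fin (r + 1) → Option (ℕ × D)} {t : ℕ} {pref : ℕ → Fin n → D}
    {poised : ℕ → Fin n → Prop} {T : ℕ}
    (hmove : ∀ i ≥ T, ∀ x ∈ P,
      (pref (i + 1) x = pref i x ∧ (poised (i + 1) x → poised i x)) ∨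
      pref (i + 1) x = newPref b (κ i) t (pref i x))
    (hwrite : ∀ i ≥ T, κ (i + 1) = κ i ∨
      (∃ x ∈ P, ∃ j, poised i x ∧ ¬ poised (i + 1) x ∧
        κ (i + 1) = Function.update (κ i) j (some (t, pref i x))) ∨
      ∃ j o, (∀ v, o ≠ some (t, v)) ∧ κ (i + 1) = Function.update (κ i) j o)
    (hfresh : ∀ N j, ∃ i ≥ N, (∃ x ∈ P, κ i j = some (t, pref i x)) ∨ ∀ v, κ i j ≠ some (t, v))
    (hscan : ∀ N, ∀ x ∈ P, ∃ i ≥ N, ¬ poised i x ∧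
      pref (i + 1) x = newPref b (κ i) t (pref i x) ∧ (∀ j, ∃ d, κ i j = some (t, d)) ∧
      ¬ Decisive m (κ i) t) : False := by
  classical
  set S : ℕ → Finset D := fun i => liveValues b P (κ i) t (pref i) with hS
  -- No value becomes live anew: a scan selects a heavy value or keeps the old preference, and only
  -- a write of a current preference raises a count.
  have hanti : ∀ i ≥ T, S (i + 1) ⊆ S i := by
    intro i hi d hd
    rw [mem_liveValues] at hd ⊢
    rcases hd with ⟨x, hx, rfl⟩ | hd
    · rcases hmove i hi x hx with ⟨h, -⟩ | h
      · exact .inl ⟨x, hx, h.symm⟩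
      · rw [h]
        rcases newPref_cases b (κ i) t (pref i x) with h | ⟨h, -⟩
        · exact .inr h
        · exact .inl ⟨x, hx, h.symm⟩
    · rcases hwrite i hi with h | ⟨x, hx, j, -, -, h⟩ | ⟨j, o, ho, h⟩
      · rw [h] at hd; exact .inr hd
      · by_cases hxd : pref i x = d
        · exact .inl ⟨x, hx, hxd⟩
        · rw [h] at hd
          exact .inr (hd.trans_le (count_update_le_of_ne _ _ (by simpa using hxd)))
      · rw [h] at hd
        exact .inr (hd.trans_le (count_update_le_of_ne _ _ (ho d)))
  obtain ⟨i₀, hi₀, hconst⟩ : ∃ i₀ ≥ T, ∀ i ≥ i₀, S i = S i₀ := by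
    have hne : (Set.Ici T).Nonempty := ⟨T, Set.mem_Ici.2 le_rfl⟩
    have hmin := Function.argminOn_mem (fun i => (S i).card) (Set.Ici T) hne
    set i₀ := Function.argminOn (fun i => (S i).card) (Set.Ici T) hne with hi₀
    have hle : ∀ i ≥ T, (S i₀).card ≤ (S i).card := fun i hi =>
      Function.argminOn_le (fun i => (S i).card) (Set.Ici T) hi
    refine ⟨i₀, hmin, fun i hi => ?_⟩
    have hsub : S i ⊆ S i₀ := by
      induction i, hi using Nat.le_induction with
      | base => exact subset_rfl
      | succ i hi ih => exact (hanti i (le_trans hmin hi)).trans ih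
    exact Finset.eq_of_subset_of_card_le hsub (hle i (le_trans hmin hi))
  have hpref : ∀ i ≥ i₀, ∀ x ∈ P, pref i x ∈ S i₀ := fun i hi x hx => by
    rw [← hconst i hi]
    exact mem_liveValues.2 (.inl ⟨x, hx, rfl⟩)
  -- With at most `m` live values, every component eventually holds only live values for operation
  -- `t`, and then a scan is decisive.
  by_cases hcard : (S i₀).card ≤ m
  · have hev : ∀ j, ∃ N, ∀ i ≥ N, ∀ v, κ i j = some (t, v) → v ∈ S i₀ := by
      intro j
      obtain ⟨N, hN, h⟩ := hfresh i₀ j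
      refine ⟨N, fun i hi => ?_⟩
      induction i, hi using Nat.le_induction with
      | base =>
        intro v hv
        rcases h with ⟨x, hx, h⟩ | h
        · rw [h] at hv
          cases hv
          exact hpref N hN x hx
        · exact absurd hv (h v)
      | succ i hi ih =>
        intro v hv
        have hi' : i₀ ≤ i := hN.trans hi
        rcases hwrite i (hi₀.trans hi') with h | ⟨x, hx, j', -, -, h⟩ | ⟨j', o, ho, h⟩ <;>
          rw [h] at hv
        · exact ih v hv
        · rw [Function.update_apply] at hv
          split_ifs at hv
          · cases hv
            exact hpref i hi' x hx
          · exact ih v hv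
        · rw [Function.update_apply] at hv
          split_ifs at hv
          · exact absurd hv (ho v)
          · exact ih v hv
    obtain ⟨N, hN⟩ := exists_eventually_forall hev
    obtain ⟨x, hx⟩ := hP
    obtain ⟨i, hi, -, -, hall, hnd⟩ := hscan N x hx
    refine hnd ⟨hall, ?_⟩
    have hsub : (Finset.univ.image (κ i)) ⊆ (S i₀).image fun v => some (t, v) := by
      intro o ho
      obtain ⟨j, -, rfl⟩ := Finset.mem_image.1 ho
      obtain ⟨v, hv⟩ := hall j
      exact Finset.mem_image.2 ⟨v, hN i hi j v hv, hv.symm⟩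
    refine le_trans (le_of_eq ?_)
      (((Finset.card_le_card hsub).trans Finset.card_image_le).trans hcard)
    congr
  rw [not_le] at hcard
  -- The processes of `P` prefer at most `m` values, so some live value is live through its copies.
  have hheavy : ∀ i ≥ i₀, ∃ d, b < count (κ i) t d := by
    intro i hi
    have hlt : (P.image (pref i)).card < (S i).card := by
      rw [hconst i hi]
      exact (Finset.card_image_le.trans hPm).trans_lt hcard
    obtain ⟨d, hd, hd'⟩ := Finset.exists_mem_notMem_of_card_lt_card hlt
    refine ⟨d, (mem_liveValues.1 hd).resolve_left ?_⟩
    rintro ⟨x, hx, h⟩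
    exact hd' (Finset.mem_image.2 ⟨x, hx, h⟩)
  -- `g i d` is the number of pending writes of `d`.
  set g : ℕ → D → ℕ := fun i d => ((P.filter (poised i)).filter fun x => pref i x = d).card with hg
  -- Once copies and pending writes of `d` number at most `b`, no scan selects `d`, and a write only
  -- turns a pending copy into an actual one. The total never grows again, and `d` dies out.
  have hkey : ∀ d ∈ S i₀, ∀ i ≥ i₀, b < count (κ i) t d + g i d := by
    intro d hd i₁ hi₁
    by_contra hle
    rw [not_lt] at hle
    have hle' : ∀ i ≥ i₁, count (κ i) t d + g i d ≤ b := by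
      intro i hi
      induction i, hi using Nat.le_induction with
      | base => exact hle
      | succ i hi ih =>
        have hi' : i₀ ≤ i := hi₁.trans hi
        have hsub : ((P.filter (poised (i + 1))).filter fun x => pref (i + 1) x = d) ⊆
            (P.filter (poised i)).filter fun x => pref i x = d := by
          intro x hx
          simp only [Finset.mem_filter] at hx ⊢
          obtain ⟨⟨hxP, hx1⟩, hx2⟩ := hx
          rcases hmove i (hi₀.trans hi') x hxP with ⟨h1, h2⟩ | h1
          · exact ⟨⟨hxP, h2 hx1⟩, h1 ▸ hx2⟩
          · exact absurd (h1.symm.trans hx2) (newPref_ne (hheavy i hi') (by omega) _)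
        have hg' : g (i + 1) d ≤ g i d := Finset.card_le_card hsub
        rcases hwrite i (hi₀.trans hi') with h | ⟨x, hx, j, hx1, hx2, h⟩ | ⟨j, o, ho, h⟩
        · rw [h]; omega
        · by_cases hxd : pref i x = d
          · have h1 := count_update_le (κ i) t d j (some (t, pref i x))
            have h2 : g (i + 1) d + 1 ≤ g i d := by
              refine Finset.card_lt_card ((Finset.ssubset_iff_of_subset hsub).2 ⟨x, ?_, ?_⟩)
              · simp [hx, hx1, hxd]
              · simp [hx2]
            rw [h]
            omega
          · have h1 := count_update_le_of_ne (κ i) (t := t) (d := d) j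
              (o := some (t, pref i x)) (by simpa using hxd)
            rw [h]
            omega
        · have h1 := count_update_le_of_ne (κ i) j (ho d)
          rw [h]
          omega
    have hev : ∀ x : P, ∃ N, ∀ i ≥ N, pref i x ≠ d := by
      rintro ⟨x, hx⟩
      obtain ⟨i, hi, -, h, -⟩ := hscan i₁ x hx
      refine ⟨i + 1, fun i' hi' => ?_⟩
      induction i', hi' using Nat.le_induction with
      | base =>
        have := hle' i hi
        rw [h]
        exact newPref_ne (hheavy i (hi₁.trans hi)) (by omega) _
      | succ i' hi' ih =>
        have hi₁' : i₁ ≤ i' := by omega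
        have := hle' i' hi₁'
        rcases hmove i' (by omega) x hx with ⟨h1, -⟩ | h1 <;> rw [h1]
        · exact ih
        · exact newPref_ne (hheavy i' (by omega)) (by omega) _
    obtain ⟨N, hN⟩ := exists_eventually_forall hev
    have hNd : d ∈ S (max N i₁) := by
      rw [hconst _ (hi₁.trans (le_max_right _ _))]
      exact hd
    rcases mem_liveValues.1 hNd with ⟨x, hx, h⟩ | h
    · exact hN _ (le_max_left _ _) ⟨x, hx⟩ h
    · have := hle' _ (le_max_right N i₁)
      omega
  obtain ⟨x, hx⟩ := hP
  -- While `x` scans, at most `m - 1` writes are pending. Summed over `m + 1` live values, `hkey`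
  -- gives `(m + 1) * (b + 1) ≤ (r + 1) + (m - 1)`, contrary to `r = (m + 1) * b`.
  obtain ⟨i, hi, hxp, -⟩ := hscan i₀ x hx
  obtain ⟨S', hS', hS'c⟩ := Finset.exists_subset_card_eq (Nat.succ_le_of_lt hcard)
  have h1 : ∑ _d ∈ S', (b + 1) ≤ ∑ d ∈ S', (count (κ i) t d + g i d) :=
    Finset.sum_le_sum fun d hd => hkey d (hS' hd) i hi
  rw [Finset.sum_const, hS'c, Finset.sum_add_distrib, smul_eq_mul] at h1
  have h2 := sum_count_le (κ i) t S'
  have h3 : ∑ d ∈ S', g i d ≤ (P.erase x).card := by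
    have h4 : ∑ d ∈ S', g i d =
        ((P.filter (poised i)).filter fun x => pref i x ∈ S').card := by
      convert Finset.sum_card_fiberwise_eq_card_filter (P.filter (poised i)) S' (pref i)
    rw [h4]
    refine Finset.card_le_card fun y hy => ?_
    simp only [Finset.mem_filter] at hy
    exact Finset.mem_erase.2 ⟨fun h => hxp (h ▸ hy.1.2), hy.1.1⟩
  rw [Finset.card_erase_of_mem hx] at h3
  have h4 : 0 < P.card := Finset.card_pos.2 ⟨x, hx⟩
  rw [Nat.mul_succ, Nat.succ_eq_add_one, ← hr] at h1
  omega

/-! ### Obstruction-freedom -/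

/-- The position of a control state in the course of an operation, counted from the moment in which
the output of the preceding operation is determined. -/
def Phase.rank : Phase D → ℕ
  | .publish _ => 0
  | .done _ => 1
  | .idle => 2
  | .update _ => 3
  | .scan _ _ => 3

/-- A measure of progress that no step decreases. -/
def Local.rank (l : Local D r) : ℕ := 4 * l.hist.length + l.phase.rank

lemma conclude_rank (l : Local D r) (d : D) (κ : Fin (r + 1) → Option (ℕ × D)) :
    4 * l.hist.length + 3 ≤ (l.conclude m b d κ).rank := by
  rcases conclude_cases (m := m) (b := b) l d κ with ⟨-, h⟩ | ⟨-, h⟩ <;> rw [h] <;>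
    simp [Local.finish, Local.rank, Phase.rank]
  omega

lemma eval_rank (l : Local D r) (d : D) (log : List (Entry D)) :
    4 * l.hist.length + 3 ≤ (l.eval n m b d log).rank := by
  rcases eval_cases (n := n) (m := m) (b := b) l d log with
    ⟨v, -, h⟩ | ⟨-, s, -, h⟩ | ⟨-, -, h⟩ <;> rw [h]
  · simp [Local.finish, Local.rank]; omega
  · exact conclude_rank _ _ _
  · simp [Local.rank, Phase.rank]

lemma LocalMove.rank_le {p : Fin n} {g : Fin (r + 2) → Entry D} {l l' : Local D r}
    {e : Event D n} (h : LocalMove m b p g l e l') : l.rank ≤ l'.rank := by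
  cases h with
  | eval d log h hge =>
    refine le_trans ?_ (eval_rank _ _ _)
    simp [Local.rank, h, Phase.rank]
  | _ => simp_all [Local.rank, Phase.rank]

lemma LocalMove.rank_lt {p : Fin n} {g : Fin (r + 2) → Entry D} {l l' : Local D r}
    {e : Event D n} (h : LocalMove m b p g l e l') (hl : l.phase.busy = 0) :
    l.rank < l'.rank := by
  cases h <;> simp_all [Local.rank, Phase.rank, Phase.busy]

lemma Phase.rank_lt (ph : Phase D) : ph.rank < 4 := by cases ph <;> simp [Phase.rank]

lemma Phase.busy_eq_zero_or_one (ph : Phase D) : ph.busy = 0 ∨ ph.busy = 1 := by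
  cases ph <;> simp [Phase.busy]

lemma Phase.busy_cases {ph : Phase D} (h : ph.busy = 1) :
    (∃ d, ph = .update d) ∨ ∃ d log, ph = .scan d log := by
  cases ph <;> simp_all [Phase.busy]

lemma core_busy (l : Local D r) : l.core.phase.busy = l.phase.busy := by
  obtain ⟨idx, ts, hist, ph⟩ := l
  cases ph <;> rfl

lemma exists_eventually_eq_of_bounded {f : ℕ → ℕ} (hf : Monotone f) {B : ℕ} (hB : ∀ i, f i ≤ B) :
    ∃ N, ∀ i ≥ N, f i = f N := by
  have hmin := fun i => Function.argmin_le (fun i => B - f i) i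
  refine ⟨Function.argmin (fun i => B - f i), fun i hi => le_antisymm ?_ (hf hi)⟩
  have h1 := hmin i
  have h2 := hB i
  have h3 := hB (Function.argmin fun i => B - f i)
  omega

namespace Run

variable (ρ : Run D n m b r)

/-- Process `p` takes infinitely many steps. -/
def Live (p : Fin n) : Prop := ∀ N, ∃ i ≥ N, ρ.Acts p i

/-- From configuration `T` on, process `p` stays in the update-scan loop of one operation. -/
def StuckFrom (p : Fin n) (T : ℕ) : Prop :=
  ∀ i ≥ T, (ρ.loc i p).phase.busy = 1 ∧ (ρ.loc i p).hist.length = (ρ.loc T p).hist.length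

/-- Process `p` writes a component in step `i`. -/
def Writes (p : Fin n) (i : ℕ) : Prop :=
  ρ.ev i = some (.compute p) ∧ ∃ d, (ρ.loc i p).phase = .update d

variable {ρ}

lemma StuckFrom.mono {p : Fin n} {T T' : ℕ} (h : ρ.StuckFrom p T) (hT : T ≤ T') :
    ρ.StuckFrom p T' := fun i hi =>
  ⟨(h i (hT.trans hi)).1, (h i (hT.trans hi)).2.trans (h T' hT).2.symm⟩

variable (ρ)

lemma rank_mono (p : Fin n) : Monotone fun i => (ρ.loc i p).rank := by
  refine monotone_nat_of_le_succ fun i => ?_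
  rcases ρ.local_step i p with ⟨-, h⟩ | ⟨e, -, -, h⟩
  · rw [h]
  · exact h.rank_le

lemma exists_next_act {p : Fin n} (hp : ρ.Live p) (i : ℕ) :
    ∃ j ≥ i, ∃ e, ρ.ev j = some e ∧ e.owner = p ∧
      LocalMove m b p (ρ.reg j) (ρ.loc i p) e (ρ.loc (j + 1) p) ∧ ρ.loc j p = ρ.loc i p := by
  classical
  have hex := hp i
  obtain ⟨hj, hact⟩ := Nat.find_spec hex
  set j := Nat.find hex with hjdef
  have hsame : ∀ k, i ≤ k → k ≤ j → ρ.loc k p = ρ.loc i p := by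
    intro k hk
    induction k, hk using Nat.le_induction with
    | base => exact fun _ => rfl
    | succ k hk ih =>
      intro hkj
      rw [← ih (by omega)]
      rcases ρ.local_step k p with ⟨-, h⟩ | ⟨e, he, heo, -⟩
      · exact h
      · exact absurd ⟨hk, e, he, heo⟩ (Nat.find_min hex (m := k) (by omega))
  obtain ⟨e, he, heo⟩ := hact
  have := hsame j hj le_rfl
  exact ⟨j, hj, e, he, heo, this ▸ ρ.local_move he heo, this⟩

/-- The rank is monotone. If it is bounded, it becomes constant, and since every step outside the
update-scan loop raises it, the process stays in the loop. If it is unbounded, so is the length of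
the history, as a phase contributes less than `4`. -/
lemma stuck_or_unbounded {p : Fin n} (hp : ρ.Live p) :
    (∃ T, ρ.StuckFrom p T) ∨ ∀ t, ∃ N, ∀ i ≥ N, t < (ρ.loc i p).hist.length := by
  by_cases hB : ∃ B, ∀ i, (ρ.loc i p).rank ≤ B
  · left
    obtain ⟨B, hB⟩ := hB
    obtain ⟨T, hT⟩ := exists_eventually_eq_of_bounded (ρ.rank_mono p) hB
    refine ⟨T, fun i hi => ⟨?_, ?_⟩⟩
    · obtain ⟨j, hj, e, -, -, hm, -⟩ := ρ.exists_next_act hp i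
      refine (Phase.busy_eq_zero_or_one _).resolve_left fun h0 => ?_
      have h1 := hm.rank_lt h0
      have h2 := hT i hi
      have h3 := hT (j + 1) (by omega)
      omega
    · have h1 := hT i hi
      have h2 := Phase.rank_lt (ρ.loc i p).phase
      have h3 := Phase.rank_lt (ρ.loc T p).phase
      simp only [Local.rank] at h1
      omega
  · right
    push Not at hB
    intro t
    obtain ⟨N, hN⟩ := hB (4 * t + 3)
    refine ⟨N, fun i hi => ?_⟩
    have h1 := ρ.rank_mono p hi
    have h2 := Phase.rank_lt (ρ.loc i p).phase
    simp only [Local.rank] at h1 hN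
    omega

lemma exists_write_of_update {p : Fin n} (hp : ρ.Live p) {i : ℕ} {d : D}
    (h : (ρ.loc i p).phase = .update d) :
    ∃ j ≥ i, ρ.Writes p j ∧ ρ.loc j p = ρ.loc i p ∧ (ρ.loc (j + 1) p).phase = .scan d [] := by
  obtain ⟨j, hj, e, he, heo, hm, hl⟩ := ρ.exists_next_act hp i
  refine ⟨j, hj, ?_⟩
  have hph : (ρ.loc j p).phase = .update d := by rw [hl, h]
  have hev : e = .compute p := by
    generalize ρ.loc (j + 1) p = l' at hm
    cases hm <;> simp_all
  subst hev
  exact ⟨⟨he, d, hph⟩, hl, by rw [ρ.loc_of_write he hph]⟩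

/-- Adopting or deciding would end the loop, so an evaluation by a stuck process either changes its
preference or restarts the scan. -/
lemma stuck_eval {p : Fin n} {T : ℕ} (hT : ρ.StuckFrom p T) {e : ℕ} (he : T ≤ e) {d : D}
    {log : List (Entry D)} (hph : (ρ.loc e p).phase = .scan d log)
    (hlen : logSize n r ≤ log.length) (hev : ρ.ev e = some (.compute p)) :
    (∀ v, ¬ Adoptable log (ρ.loc e p).hist.length v) ∧
    ((∃ s, ρ.Concludes e p d s ∧ ¬ Decisive m (fun j => (s j).key) (ρ.loc e p).hist.length ∧
      ρ.loc (e + 1) p = { ρ.loc e p with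
        idx := (ρ.loc e p).idx + 1
        phase := .update (newPref b (fun j => (s j).key) (ρ.loc e p).hist.length d) }) ∨
    (∀ s : Fin (r + 1) → Entry D, ¬ Uniform n log s) ∧
      ρ.loc (e + 1) p = { ρ.loc e p with phase := .scan d [] }) := by
  have hloc : ρ.loc (e + 1) p = (ρ.loc e p).eval n m b d log := by
    have hm := ρ.local_move (p := p) hev rfl
    generalize ρ.loc (e + 1) p = l' at hm
    cases hm with
    | read d' log' h hlt => rw [hph] at h; cases h; omega
    | eval d' log' h hge => rw [hph] at h; cases h; rfl
    | _ => simp_all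
  have hbusy := (hT (e + 1) (by omega)).1
  rcases eval_cases (n := n) (m := m) (b := b) (ρ.loc e p) d log with
    ⟨v, -, h⟩ | ⟨hA, s, hs, h⟩ | ⟨hA, hs, h⟩
  · rw [hloc, h] at hbusy
    simp [Local.finish, Phase.busy] at hbusy
  · refine ⟨hA, .inl ⟨s, ⟨log, hph, hlen, hev, hA, hs, hloc.trans h⟩, ?_⟩⟩
    rcases conclude_cases (m := m) (b := b) (ρ.loc e p) d (fun j => (s j).key) with
      ⟨-, h'⟩ | ⟨hD, h'⟩
    · rw [hloc, h, h'] at hbusy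
      simp [Local.finish, Phase.busy] at hbusy
    · exact ⟨hD, (hloc.trans h).trans h'⟩
  · exact ⟨hA, .inr ⟨hs, hloc.trans h⟩⟩

/-- Induction on the number `k` of missing reads; `R` is a property shared by all reads after `N`.
-/
lemma exists_full_log {p : Fin n} (hp : ρ.Live p) {R : ℕ → Entry D → Prop} {N : ℕ}
    (hR : ∀ i ≥ N, ∀ l, R l (ρ.reg i (Fin.ofNat (r + 2) l))) {d : D} (k : ℕ) :
    ∀ i ≥ N, ∀ log, (ρ.loc i p).phase = .scan d log → logSize n r ≤ log.length + k →
      (∀ l x, log[l]? = some x → R l x) →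
      ∃ e ≥ i, ∃ log, (ρ.loc e p).phase = .scan d log ∧ logSize n r ≤ log.length ∧
        ρ.ev e = some (.compute p) ∧ ∀ l x, log[l]? = some x → R l x := by
  induction k with
  | zero =>
    intro i _ log hph hlen hlog
    obtain ⟨j, hj, e, he, -, hm, hl⟩ := ρ.exists_next_act hp i
    refine ⟨j, hj, log, by rw [hl, hph], hlen, ?_, hlog⟩
    rw [he]
    generalize ρ.loc (j + 1) p = l' at hm
    cases hm <;> simp_all
  | succ k ih =>
    intro i hi log hph hlen hlog
    obtain ⟨j, hj, e, he, -, hm, hl⟩ := ρ.exists_next_act hp i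
    generalize hl' : ρ.loc (j + 1) p = l' at hm
    cases hm with
    | read d' log' h hlt =>
      rw [hph] at h
      cases h
      obtain ⟨e, he, hc⟩ := ih (j + 1) (by omega)
        (log ++ [ρ.reg j (Fin.ofNat (r + 2) log.length)]) (by rw [hl'])
        (by rw [List.length_append, List.length_singleton]; omega) (by
          intro l x hx
          rcases lt_trichotomy l log.length with h | rfl | h
          · rw [List.getElem?_append_left h] at hx
            exact hlog l x hx
          · rw [List.getElem?_concat_length] at hx
            cases hx
            exact hR j (by omega) _
          · rw [List.getElem?_eq_none (by simp; omega)] at hx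
            cases hx)
      exact ⟨e, by omega, hc⟩
    | eval d' log' h hge =>
      rw [hph] at h
      cases h
      exact ⟨j, hj, log, by rw [hl, hph], hge, he, hlog⟩
    | _ => simp_all

lemma exists_scan_start {p : Fin n} (hp : ρ.Live p) {T : ℕ} (hT : ρ.StuckFrom p T) (N : ℕ) :
    ∃ i ≥ N, ∃ d, (ρ.loc i p).phase = .scan d [] := by
  have hN : T ≤ max N T := le_max_right _ _
  have hupd : ∀ i ≥ max N T, ∀ d, (ρ.loc i p).phase = .update d →
      ∃ i ≥ N, ∃ d, (ρ.loc i p).phase = .scan d [] := by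
    intro i hi d h
    obtain ⟨j, hj, -, -, h'⟩ := ρ.exists_write_of_update hp h
    exact ⟨j + 1, by omega, d, h'⟩
  rcases Phase.busy_cases (hT _ hN).1 with ⟨d, h⟩ | ⟨d, log, h⟩
  · exact hupd _ le_rfl d h
  · obtain ⟨e, he, log', h1, h2, h3, -⟩ := ρ.exists_full_log hp (R := fun _ _ => True)
      (N := max N T) (fun _ _ _ => trivial) (logSize n r) _ le_rfl log h (by omega)
      (fun _ _ _ => trivial)
    rcases (ρ.stuck_eval hT (by omega) h1 h2 h3).2 with ⟨s, -, -, h4⟩ | ⟨-, h4⟩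
    · exact hupd (e + 1) (by omega) _ (by rw [h4])
    · exact ⟨e + 1, by omega, d, by rw [h4]⟩

/-- A stuck process completes logs that consist of reads after any given moment. -/
lemma exists_fresh_log {p : Fin n} (hp : ρ.Live p) {T : ℕ} (hT : ρ.StuckFrom p T) (N : ℕ) :
    ∃ e ≥ N, ∃ d log, (ρ.loc e p).phase = .scan d log ∧ logSize n r ≤ log.length ∧
      ρ.ev e = some (.compute p) ∧
      ∀ l x, log[l]? = some x → ∃ i ≥ N, x = ρ.reg i (Fin.ofNat (r + 2) l) := by
  obtain ⟨i, hi, d, h⟩ := ρ.exists_scan_start hp hT N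
  obtain ⟨e, he, log, h1⟩ := ρ.exists_full_log hp
    (R := fun l x => ∃ i ≥ N, x = ρ.reg i (Fin.ofNat (r + 2) l)) (N := N)
    (fun i hi l => ⟨i, hi, rfl⟩) (logSize n r) i hi [] h (by simp) (by simp)
  exact ⟨e, by omega, d, log, h1⟩

lemma lt_logSize {c j : ℕ} (hc : c < n * (r + 1) + 2) (hj : j < r + 2) :
    c * (r + 2) + j < logSize n r :=
  calc c * (r + 2) + j < (c + 1) * (r + 2) := by rw [Nat.succ_mul]; omega
    _ ≤ logSize n r := Nat.mul_le_mul_right _ hc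

lemma publish_of_lt_hist_length {i : ℕ} {p : Fin n}
    (h : (ρ.loc i p).hist.length < (ρ.loc (i + 1) p).hist.length) :
    ∃ d, (ρ.loc (i + 1) p).phase = .publish d := by
  rcases ρ.local_step i p with ⟨-, hl⟩ | ⟨e, -, -, hm⟩
  · rw [hl] at h; omega
  generalize ρ.loc (i + 1) p = l' at hm h ⊢
  cases hm with
  | eval d log _ _ =>
    rcases eval_cases (n := n) (m := m) (b := b) (ρ.loc i p) d log with
      ⟨v, -, hv⟩ | ⟨-, s, -, hv⟩ | ⟨-, -, hv⟩
    · rw [hv]; exact ⟨v, rfl⟩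
    · rcases conclude_cases (m := m) (b := b) (ρ.loc i p) d (fun j => (s j).key) with
        ⟨-, h'⟩ | ⟨-, h'⟩
      · rw [hv, h']; exact ⟨_, rfl⟩
      · rw [hv, h'] at h; exact absurd h (lt_irrefl _)
    · rw [hv] at h; exact absurd h (lt_irrefl _)
  | _ => exact absurd h (lt_irrefl _)

lemma reg_of_write {i : ℕ} {p : Fin n} {d : D} (he : ρ.ev i = some (.compute p))
    (hp : (ρ.loc i p).phase = .update d) : ρ.reg (i + 1) =
      Function.update (ρ.reg i) (ρ.loc i p).idx.castSucc ((ρ.loc i p).entry d) := by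
  have h := ρ.move i
  rw [he] at h
  generalize ρ.reg (i + 1) = g', ρ.loc (i + 1) = l' at h ⊢
  cases h with
  | write _ d h => rw [hp] at h; cases h; rfl
  | _ => simp_all

lemma reg_of_publish {i : ℕ} {p : Fin n} {d : D} (he : ρ.ev i = some (.compute p))
    (hp : (ρ.loc i p).phase = .publish d) : ρ.reg (i + 1) =
      Function.update (ρ.reg i) (Fin.last (r + 1)) ⟨none, (ρ.loc i p).hist, 0⟩ := by
  have h := ρ.move i
  rw [he] at h
  generalize ρ.reg (i + 1) = g', ρ.loc (i + 1) = l' at h ⊢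
  cases h with
  | publish _ d h => rfl
  | _ => simp_all

lemma exists_publish {q : Fin n} (hq : ρ.Live q)
    (hub : ∀ t, ∃ N, ∀ i ≥ N, t < (ρ.loc i q).hist.length) (N : ℕ) :
    ∃ i ≥ N, ρ.ev i = some (.compute q) ∧ ∃ d, (ρ.loc i q).phase = .publish d := by
  have hex : ∃ i ≥ N, ∃ d, (ρ.loc i q).phase = .publish d := by
    by_contra hcon
    push Not at hcon
    have hle : ∀ i ≥ N, (ρ.loc i q).hist.length ≤ (ρ.loc N q).hist.length := by
      intro i hi
      induction i, hi using Nat.le_induction with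
      | base => exact le_rfl
      | succ i hi ih =>
        refine le_trans (not_lt.1 fun h => ?_) ih
        obtain ⟨d, hd⟩ := ρ.publish_of_lt_hist_length h
        exact hcon (i + 1) (by omega) d hd
    obtain ⟨N', hN'⟩ := hub (ρ.loc N q).hist.length
    have h1 := hN' (max N N') (le_max_right _ _)
    have h2 := hle (max N N') (le_max_left _ _)
    omega
  obtain ⟨i, hi, d, hd⟩ := hex
  obtain ⟨j, hj, e, he, -, hm, hl⟩ := ρ.exists_next_act hq i
  refine ⟨j, by omega, ?_, d, by rw [hl, hd]⟩
  rw [he]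
  generalize ρ.loc (j + 1) q = l' at hm
  cases hm <;> simp_all

/-- If some process completes infinitely many operations, no process takes infinitely many steps
in a single operation. -/
theorem not_stuck_of_unbounded {p q : Fin n} (hp : ρ.Live p) {T : ℕ} (hT : ρ.StuckFrom p T)
    (hq : ρ.Live q) (hub : ∀ t, ∃ N, ∀ i ≥ N, t < (ρ.loc i q).hist.length) : False := by
  set t := (ρ.loc T p).hist.length with ht
  -- Eventually, a process that still acts is either in its loop, where it does not publish, or has
  -- a history longer than `t`. So only long histories are published from then on.
  have hev : ∀ x, ∃ N, ∀ i ≥ N,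
      ¬ ρ.Acts x i ∨ (ρ.loc i x).phase.busy = 1 ∨ t < (ρ.loc i x).hist.length := by
    intro x
    by_cases hx : ρ.Live x
    · rcases ρ.stuck_or_unbounded hx with ⟨N, hN⟩ | h
      · exact ⟨N, fun i hi => .inr (.inl (hN i hi).1)⟩
      · obtain ⟨N, hN⟩ := h t
        exact ⟨N, fun i hi => .inr (.inr (hN i hi))⟩
    · unfold Live at hx
      push Not at hx
      obtain ⟨N, hN⟩ := hx
      exact ⟨N, fun i hi => .inl (hN i hi)⟩
  obtain ⟨N, hN⟩ := exists_eventually_forall hev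
  have hpub : ∀ i ≥ N, ∀ x d, ρ.ev i = some (.compute x) → (ρ.loc i x).phase = .publish d →
      t < (ρ.loc i x).hist.length := by
    intro i hi x d he hd
    rcases hN i hi x with h | h | h
    · exact absurd ⟨_, he, rfl⟩ h
    · simp [hd, Phase.busy] at h
    · exact h
  obtain ⟨i₀, hi₀, he, d, hd⟩ := ρ.exists_publish hq hub N
  have hlast : ∀ i > i₀, t < (ρ.reg i (Fin.last (r + 1))).hist.length := by
    intro i hi
    induction i, hi using Nat.le_induction with
    | base =>
      rw [Nat.succ_eq_add_one, ρ.reg_of_publish he hd, Function.update_self]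
      exact hpub i₀ hi₀ q d he hd
    | succ i hi ih =>
      rcases ρ.reg_step i with h | ⟨x, d', he', hd', h⟩ | ⟨x, d', he', hd', h⟩
      · rw [h]; exact ih
      · rw [h, Function.update_of_ne (Fin.castSucc_lt_last _).ne']; exact ih
      · rw [h, Function.update_self]
        exact hpub i (by have := hi; omega) x d' he' hd'
  obtain ⟨e, hee, d', log, h1, h2, h3, h4⟩ := ρ.exists_fresh_log hp hT (max (i₀ + 1) T)
  have hlt : r + 1 < log.length := by
    refine lt_of_lt_of_le ?_ h2
    simpa using lt_logSize (n := n) (r := r) (c := 0) (j := r + 1) (by omega) (by omega)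
  -- Read number `r + 1`, counted from `0`, is the first read of the extra register.
  obtain ⟨i, hi, hx⟩ := h4 (r + 1) _ (List.getElem?_eq_getElem hlt)
  have hcast : Fin.ofNat (r + 2) (r + 1) = Fin.last (r + 1) := by
    apply Fin.ext
    simp
  rw [hcast] at hx
  have hlong := hlast i (by omega)
  rw [← hx] at hlong
  refine (ρ.stuck_eval hT (by omega) h1 h2 h3).1 (log[r + 1].hist[t])
    ⟨_, List.getElem_mem hlt, ?_⟩
  rw [(hT e (by omega)).2]
  exact List.getElem?_eq_getElem hlong

end Run

/-- The preference recorded in a control state, with default value `v`. -/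
def Phase.pref (v : D) : Phase D → D
  | .update d => d
  | .scan d _ => d
  | _ => v

namespace Run

variable (ρ : Run D n m b r)

/-- Between two writes of a stuck process there is a scan. -/
lemma exists_concludes_of_writes {x : Fin n} {T : ℕ} (hT : ρ.StuckFrom x T) {i₁ i₂ : ℕ}
    (h₁ : T ≤ i₁) (h₁₂ : i₁ < i₂) (hw₁ : ρ.Writes x i₁) (hw₂ : ρ.Writes x i₂) :
    ∃ e d s, i₁ < e ∧ ρ.Concludes e x d s ∧
      ¬ Decisive m (fun j => (s j).key) (ρ.loc e x).hist.length ∧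
      ρ.loc (e + 1) x = { ρ.loc e x with
        idx := (ρ.loc i₁ x).idx + 1
        phase := .update (newPref b (fun j => (s j).key) (ρ.loc e x).hist.length d) } := by
  by_contra hcon
  have hscan : ∀ i > i₁,
      (∃ d log, (ρ.loc i x).phase = .scan d log) ∧ (ρ.loc i x).idx = (ρ.loc i₁ x).idx := by
    intro i hi
    induction i, hi using Nat.le_induction with
    | base =>
      obtain ⟨he, d, hd⟩ := hw₁
      rw [Nat.succ_eq_add_one, ρ.loc_of_write he hd]
      exact ⟨⟨d, [], rfl⟩, rfl⟩
    | succ i hi ih =>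
      obtain ⟨⟨d, log, hph⟩, hidx⟩ := ih
      rcases ρ.local_step i x with ⟨-, h⟩ | ⟨e, he, -, h⟩
      · rw [h]; exact ⟨⟨d, log, hph⟩, hidx⟩
      generalize hl' : ρ.loc (i + 1) x = l' at h
      cases h with
      | read d' log' h hlt => exact ⟨⟨_, _, rfl⟩, hidx⟩
      | eval d' log' h hge =>
        have hi' : T ≤ i := by have := hi; omega
        rcases (ρ.stuck_eval hT hi' h hge he).2 with ⟨s, hs1, hs2, hs3⟩ | ⟨-, hs⟩
        · exact absurd ⟨i, d', s, hi, hs1, hs2, by rw [hs3, hidx]⟩ hcon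
        · rw [hl'] at hs
          rw [hs]
          exact ⟨⟨_, _, rfl⟩, hidx⟩
      | _ => simp_all
  obtain ⟨-, d, hd⟩ := hw₂
  obtain ⟨⟨d', log, h⟩, -⟩ := hscan i₂ h₁₂
  rw [hd] at h
  cases h

lemma Writes.acts {ρ : Run D n m b r} {x : Fin n} {i : ℕ} (h : ρ.Writes x i) : ρ.Acts x i :=
  ⟨_, h.1, rfl⟩

/-- A stuck process that writes infinitely often writes every component infinitely often. -/
lemma exists_write_idx {x : Fin n} {T : ℕ} (hT : ρ.StuckFrom x T)
    (hw : ∀ N, ∃ i ≥ N, ρ.Writes x i) (N : ℕ) (j : Fin (r + 1)) :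
    ∃ i ≥ N, ρ.Writes x i ∧ (ρ.loc i x).idx = j := by
  have hlive : ρ.Live x := fun N => by
    obtain ⟨i, hi, h⟩ := hw N
    exact ⟨i, hi, h.acts⟩
  obtain ⟨i₀, hi₀, hw₀⟩ := hw (max N T)
  -- Each indecisive scan between writes advances the index by one modulo `r + 1`, so a suitable `k`
  -- reaches any component.
  have hall : ∀ k : ℕ, ∃ i ≥ i₀, ρ.Writes x i ∧
      (ρ.loc i x).idx = (ρ.loc i₀ x).idx + Fin.ofNat (r + 1) k := by
    intro k
    induction k with
    | zero => exact ⟨i₀, le_rfl, hw₀, by simp⟩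
    | succ k ih =>
      obtain ⟨i, hi, hwi, hidx⟩ := ih
      obtain ⟨i', hi', hwi'⟩ := hw (i + 1)
      obtain ⟨e, d, s, he, -, -, hl⟩ :=
        ρ.exists_concludes_of_writes hT (by omega) (by omega) hwi hwi'
      obtain ⟨j', hj', hwj, hlj, -⟩ := ρ.exists_write_of_update hlive
        (congrArg Local.phase hl)
      refine ⟨j', by omega, hwj, ?_⟩
      rw [hlj, hl]
      simp only [hidx]
      rw [add_assoc]
      congr 1
      apply Fin.ext
      simp [Fin.val_add]
  obtain ⟨i, hi, hwi, hidx⟩ := hall (j - (ρ.loc i₀ x).idx).val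
  refine ⟨i, by omega, hwi, ?_⟩
  rw [hidx]
  simp

/-- If all processes that take infinitely many steps are stuck in an operation, then there are
infinitely many writes to the components. -/
lemma exists_writes_of_stuck {p : Fin n} (hp : ρ.Live p) {T : ℕ} (hT : ρ.StuckFrom p T) (N : ℕ) :
    ∃ i ≥ N, ∃ x, ρ.Writes x i := by
  by_contra hcon
  push Not at hcon
  set N' := max N T with hN'
  have hconst : ∀ i ≥ N', ∀ j : Fin (r + 1), ρ.reg i j.castSucc = ρ.reg N' j.castSucc := by
    intro i hi j
    induction i, hi using Nat.le_induction with
    | base => rfl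
    | succ i hi ih =>
      rcases ρ.reg_step i with h | ⟨x, d, he, hd, h⟩ | ⟨x, d, he, hd, h⟩
      · rw [h, ih]
      · exact absurd ⟨he, d, hd⟩ (hcon i (le_trans (le_max_left _ _) hi) x)
      · rw [h, Function.update_of_ne (Fin.castSucc_lt_last j).ne, ih]
  obtain ⟨e, he, d, log, h1, h2, h3, h4⟩ := ρ.exists_fresh_log hp hT N'
  -- All collects of a log read after the last write to a component agree, so the scan succeeds and
  -- forces another write.
  have hu : Uniform n log fun j : Fin (r + 1) => ρ.reg N' j.castSucc := by
    intro c hc j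
    have hlt := (lt_logSize (n := n) (r := r) hc (j := j) (by omega)).trans_le h2
    obtain ⟨i, hi, hx⟩ := h4 _ _ (List.getElem?_eq_getElem hlt)
    rw [List.getElem?_eq_getElem hlt, hx]
    have hcast : (Fin.ofNat (r + 2) (c * (r + 2) + ↑j)) = j.castSucc := by
      apply Fin.ext
      simp only [Fin.val_ofNat, Fin.val_castSucc]
      rw [Nat.mul_add_mod_of_lt (by omega)]
    rw [hcast, hconst i hi]
  have heT : T ≤ e := le_trans (le_max_right _ _) he
  rcases (ρ.stuck_eval hT heT h1 h2 h3).2 with ⟨s, -, -, hs⟩ | ⟨h, -⟩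
  · obtain ⟨j, hj, hw, -⟩ := ρ.exists_write_of_update hp (congrArg Local.phase hs)
    have : N ≤ e := le_trans (le_max_left _ _) he
    exact hcon j (by omega) p hw
  · exact h _ hu

lemma atomicState_of_stuck {x : Fin n} {T : ℕ} (hT : ρ.StuckFrom x T) {i : ℕ} (hi : T ≤ i) :
    (ρ.atomicState i x).phase.busy = 1 ∧
      (ρ.atomicState i x).hist.length = (ρ.loc T x).hist.length := by
  have h := hT _ (hi.trans (ρ.le_ahead x i))
  exact ⟨by rw [atomicState, core_busy, h.1], by rw [atomicState, core_hist, h.2]⟩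

/-- At most `m` processes that take infinitely many steps cannot all be stuck in an operation. -/
theorem not_all_stuck (hr : r = (m + 1) * b) (hm : {x | ρ.Live x}.encard ≤ m)
    (hstuck : ∀ x, ρ.Live x → ∃ T, ρ.StuckFrom x T) {p : Fin n} (hp : ρ.Live p) : False := by
  classical
  obtain ⟨T₀, hT₀⟩ := hstuck p hp
  -- A process may scan forever without success; it does not influence the components and is left
  -- out.
  set W : Finset (Fin n) := Finset.univ.filter fun x => ∀ N, ∃ i ≥ N, ρ.Writes x i with hW
  have hWw : ∀ x ∈ W, ∀ N, ∃ i ≥ N, ρ.Writes x i := fun x hx => (Finset.mem_filter.1 hx).2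
  have hWlive : ∀ x ∈ W, ρ.Live x := fun x hx N => by
    obtain ⟨i, hi, h⟩ := hWw x hx N
    exact ⟨i, hi, h.acts⟩
  obtain ⟨T, hT⟩ : ∃ T, ∀ i ≥ T, ∀ x, (ρ.Writes x i → x ∈ W) ∧ (x ∈ W → ρ.StuckFrom x i) := by
    refine exists_eventually_forall fun x => ?_
    by_cases hx : x ∈ W
    · obtain ⟨T, hT⟩ := hstuck x (hWlive x hx)
      exact ⟨T, fun i hi => ⟨fun _ => hx, fun _ => hT.mono hi⟩⟩
    · have : ¬ ∀ N, ∃ i ≥ N, ρ.Writes x i := fun h =>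
        hx (Finset.mem_filter.2 ⟨Finset.mem_univ _, h⟩)
      push Not at this
      obtain ⟨N, hN⟩ := this
      exact ⟨N, fun i hi => ⟨fun h => absurd h (hN i hi), fun h => absurd h hx⟩⟩
  have hWne : W.Nonempty := by
    obtain ⟨i, hi, x, hx⟩ := ρ.exists_writes_of_stuck hp hT₀ T
    exact ⟨x, (hT i hi x).1 hx⟩
  have hS : ∀ x ∈ W, ρ.StuckFrom x T := fun x hx => (hT T le_rfl x).2 hx
  -- In the earliest operation of the writers, eventually no component shows an older key, and a
  -- concluding scan sees no newer one. So all keys that it sees belong to this operation.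
  obtain ⟨y, hyW, hymin⟩ := Finset.exists_min_image W (fun x => (ρ.loc T x).hist.length) hWne
  set t := (ρ.loc T y).hist.length with ht
  set P := W.filter fun x => (ρ.loc T x).hist.length = t with hP
  have hPW : ∀ x ∈ P, x ∈ W := fun x hx => (Finset.mem_filter.1 hx).1
  have hPt : ∀ x ∈ P, (ρ.loc T x).hist.length = t := fun x hx => (Finset.mem_filter.1 hx).2
  have hPm : P.card ≤ m := by
    have h1 : ((P : Set (Fin n))).encard ≤ m :=
      (Set.encard_le_encard fun x hx => hWlive x (hPW x hx)).trans hm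
    rw [Set.encard_coe_eq_coe_finsetCard] at h1
    exact_mod_cast h1
  -- Only a formal default: from `T` on, processes of `P` always have a preference.
  obtain ⟨v₀⟩ : Nonempty D := by
    obtain ⟨i, -, -, d, -⟩ := hWw y hyW 0
    exact ⟨d⟩
  set κ : ℕ → Fin (r + 1) → Option (ℕ × D) := fun i j => (ρ.reg i j.castSucc).key with hκ
  have hκwrite : ∀ i x d, ρ.ev i = some (.compute x) → (ρ.loc i x).phase = .update d →
      κ (i + 1) = Function.update (κ i) (ρ.loc i x).idx
        (some ((ρ.loc i x).hist.length, d)) := by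
    intro i x d he hd
    funext j
    simp only [hκ, ρ.reg_of_write he hd, Function.update_apply, Fin.castSucc_inj]
    split_ifs <;> rfl
  have hκstep : ∀ i ≥ T, κ (i + 1) = κ i ∨ ∃ x ∈ W, ∃ d, ρ.ev i = some (.compute x) ∧
      (ρ.loc i x).phase = .update d ∧ κ (i + 1) = Function.update (κ i) (ρ.loc i x).idx
        (some ((ρ.loc T x).hist.length, d)) := by
    intro i hi
    rcases ρ.reg_step i with h | ⟨x, d, he, hd, -⟩ | ⟨x, d, he, hd, h⟩
    · left; funext j; simp only [hκ, h]
    · right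
      have hx := (hT i hi x).1 ⟨he, d, hd⟩
      refine ⟨x, hx, d, he, hd, ?_⟩
      rw [hκwrite i x d he hd, (hS x hx i hi).2]
    · left
      funext j
      simp only [hκ, h, Function.update_of_ne (Fin.castSucc_lt_last j).ne]
  have hlate : ∃ N, ∀ i ≥ N, ∀ j, ∃ t' v, t ≤ t' ∧ κ i j = some (t', v) := by
    refine exists_eventually_forall fun j => ?_
    obtain ⟨i, hi, ⟨he, d, hd⟩, hidx⟩ := ρ.exists_write_idx (hS y hyW) (hWw y hyW) T j
    refine ⟨i + 1, fun i' hi' => ?_⟩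
    induction i', hi' using Nat.le_induction with
    | base =>
      rw [hκwrite i y d he hd, hidx, Function.update_self, (hS y hyW i hi).2]
      exact ⟨_, d, le_rfl, rfl⟩
    | succ i' hi' ih =>
      rcases hκstep i' (by omega) with h | ⟨x, hx, d', -, -, h⟩ <;> rw [h]
      · exact ih
      · rw [Function.update_apply]
        split_ifs
        · exact ⟨_, d', hymin x hx, rfl⟩
        · exact ih
  obtain ⟨N₁, hN₁⟩ := hlate
  refine not_forever_indecisive (n := n) (b := b) hr (P := P)
    ⟨y, Finset.mem_filter.2 ⟨hyW, rfl⟩⟩ hPm (κ := κ) (t := t)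
    (pref := fun i x => (ρ.atomicState i x).phase.pref v₀)
    (poised := fun i x => ∃ d, (ρ.atomicState i x).phase = .update d) (T := T) ?_ ?_ ?_ ?_
  · intro i hi x hx
    obtain ⟨hb, hlen⟩ := ρ.atomicState_of_stuck (hS x (hPW x hx)) hi
    obtain ⟨hb', -⟩ := ρ.atomicState_of_stuck (hS x (hPW x hx)) (hi.trans (Nat.le_succ i))
    rw [hPt x hx] at hlen
    have hmv := ρ.atomicMove i x
    generalize ρ.atomicState (i + 1) x = l' at hmv hb' ⊢
    cases hmv with
    | stay => exact .inl ⟨rfl, id⟩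
    | invoke v h => rw [h] at hb; simp [Phase.busy] at hb
    | write d h => left; simp [h, Phase.pref]
    | conclude d h hle =>
      right
      rcases conclude_cases (m := m) (b := b) (ρ.atomicState i x) d
        (fun j : Fin (r + 1) => (ρ.reg i j.castSucc).key) with ⟨-, h'⟩ | ⟨-, h'⟩
      · rw [h'] at hb'; simp [Local.finish, Phase.busy] at hb'
      · rw [h', h, hlen]; rfl
    | adopt d v h => simp [Local.finish, Phase.busy] at hb'
    | publish d h => rw [h] at hb; simp [Phase.busy] at hb
    | respond d h => rw [h] at hb; simp [Phase.busy] at hb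
  · intro i hi
    rcases hκstep i hi with h | ⟨x, hx, d, he, hd, h⟩
    · exact .inl h
    right
    by_cases hxt : (ρ.loc T x).hist.length = t
    · left
      obtain ⟨h1, h2⟩ := ρ.atomicState_of_write he hd
      refine ⟨x, Finset.mem_filter.2 ⟨hx, hxt⟩, (ρ.loc i x).idx, ⟨d, by rw [h1, hd]⟩, ?_, ?_⟩
      · rw [h2, ρ.loc_of_write he hd]
        simp
      · rw [h, hxt, h1, hd]; rfl
    · right
      exact ⟨_, _, fun v hv => hxt (Prod.mk.inj (Option.some.inj hv)).1, h⟩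
  · intro N j
    obtain ⟨i, hi, ⟨he, d, hd⟩, hidx⟩ :=
      ρ.exists_write_idx (hS y hyW) (hWw y hyW) (max N T) j
    refine ⟨i + 1, by omega, .inl ⟨y, Finset.mem_filter.2 ⟨hyW, rfl⟩, ?_⟩⟩
    rw [hκwrite i y d he hd, hidx, Function.update_self, (hS y hyW i (by omega)).2,
      (ρ.atomicState_of_write he hd).2, ρ.loc_of_write he hd]
    rfl
  · intro N x hx
    have hxW := hPW x hx
    obtain ⟨i₁, hi₁, hw₁⟩ := hWw x hxW (max N (max N₁ T))
    obtain ⟨i₂, hi₂, hw₂⟩ := hWw x hxW (i₁ + 1)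
    obtain ⟨e, d, s, he, hc, hD, hl⟩ :=
      ρ.exists_concludes_of_writes (hS x hxW) (by omega) (by omega) hw₁ hw₂
    -- At the first write the process is not scanning, so the scan is linearized later.
    have hlin : i₁ < ρ.linPoint x e := by
      by_contra hle
      obtain ⟨log, hlog⟩ := ρ.phase_of_linPoint_le hc (not_lt.1 hle) he.le
      obtain ⟨-, d', hd'⟩ := hw₁
      rw [hd'] at hlog
      cases hlog
    have hs : κ (ρ.linPoint x e) = fun j => (s j).key :=
      funext fun j => congrArg Entry.key ((ρ.linPoint_spec hc).2.1 j)
    obtain ⟨h1, h2⟩ := ρ.atomicState_concludes hc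
    have hlen : (ρ.loc e x).hist.length = t := by
      rw [(hS x hxW e (by omega)).2, hPt x hx]
    rw [hlen] at hD hl
    refine ⟨ρ.linPoint x e, by omega, ?_, ?_, fun j => ?_, by rwa [hs]⟩
    · rw [h1]; simp
    · simp only [h1, h2, hl, hs]; rfl
    · obtain ⟨t', v, ht', hv⟩ := hN₁ (ρ.linPoint x e) (by omega) j
      have h3 := ρ.length_hist_of_key hv
      rw [(ρ.linPoint_spec hc).2.1 j] at h3
      have h4 := ρ.length_hist_le_of_concludes hc j
      have : t' = t := by omega
      exact ⟨v, this ▸ hv⟩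

/-- Without a response there is no further invocation, so the history gains at most one output. -/
lemma hist_length_le_of_no_response {p : Fin n} {i₀ : ℕ} {v : D}
    (h₀ : ρ.ev i₀ = some (.invoke p v)) (hno : ∀ j > i₀, ∀ d, ρ.ev j ≠ some (.respond p d))
    (i : ℕ) (hi : i₀ < i) : (ρ.loc i p).phase ≠ .idle ∧
      (ρ.loc i p).hist.length + (ρ.loc i p).phase.busy = (ρ.loc i₀ p).hist.length + 1 := by
  induction i, hi using Nat.le_induction with
  | base =>
    have hm := ρ.local_move (p := p) h₀ rfl
    generalize ρ.loc (i₀ + 1) p = l' at hm ⊢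
    cases hm with
    | invoke _ h => simp [Phase.busy]
  | succ i hi ih =>
    obtain ⟨ih1, ih2⟩ := ih
    rw [← ih2]
    rcases ρ.local_step i p with ⟨-, h⟩ | ⟨e, he, -, h⟩
    · rw [h]; exact ⟨ih1, rfl⟩
    generalize ρ.loc (i + 1) p = l' at h ⊢
    cases h with
    | invoke v h => exact absurd h ih1
    | write d h => simp [h, Phase.busy]
    | read d log h hlt => simp [h, Phase.busy]
    | eval d log h hge =>
      exact ⟨eval_phase_ne_idle _ _ _, by rw [eval_count, h]; rfl⟩
    | publish d h => simp [h, Phase.busy]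
    | respond d h => exact absurd he (hno i hi d)

end Run

theorem obstructionFree (hr : r = (m + 1) * b) :
    ObstructionFree (algorithm D n m b r) n m := by
  intro α hlen hm p hp i₀ v hi₀
  have hiff : ∀ x, α.InfinitelyManySteps x ↔ (Run.ofExecution α).Live x := by
    intro x
    have : {i : ℕ | ∃ e, α.Occurs i e ∧ e.owner = x} = {i | (Run.ofExecution α).Acts x i} := by
      ext i
      simp only [Run.Acts, Run.ofExecution_ev_eq]
    rw [Execution.InfinitelyManySteps, this, Set.infinite_iff_exists_gt]
    constructor
    · intro h N
      obtain ⟨i, hi, hlt⟩ := h N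
      exact ⟨i, hlt.le, hi⟩
    · intro h N
      obtain ⟨i, hi, hact⟩ := h (N + 1)
      exact ⟨i, hact, hi⟩
  by_contra hcon
  push Not at hcon
  simp only [← Run.ofExecution_ev_eq] at hcon hi₀
  set ρ := Run.ofExecution α with hρ
  have hpend := ρ.hist_length_le_of_no_response hi₀ hcon
  rcases hp with hp | ⟨N, hN⟩
  · rw [hiff] at hp
    rcases ρ.stuck_or_unbounded hp with ⟨T, hT⟩ | hub
    · by_cases hex : ∃ q, ρ.Live q ∧ ∀ t, ∃ N, ∀ i ≥ N, t < (ρ.loc i q).hist.length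
      · obtain ⟨q, hq, hub⟩ := hex
        exact ρ.not_stuck_of_unbounded hp hT hq hub
      · refine ρ.not_all_stuck hr (by simpa only [hiff] using hm) (fun x hx => ?_) hp
        exact (ρ.stuck_or_unbounded hx).resolve_right fun h => hex ⟨x, hx, h⟩
    · obtain ⟨N, hN⟩ := hub ((ρ.loc i₀ p).hist.length + 1)
      have h1 := hN (max N (i₀ + 1)) (le_max_left _ _)
      have h2 := (hpend (max N (i₀ + 1)) (by omega)).2
      omega
  · have h1 := hN (max N (i₀ + 1)) (le_max_left _ _)
    rw [active_iff α _ (by rw [hlen]; exact le_top)] at h1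
    refine (hpend (max N (i₀ + 1)) (by omega)).1 ?_
    simpa [hρ, Run.ofExecution, hlen] using h1

theorem solves (hr : r = (m + 1) * b) {k : ℕ} (hb : b + k + 1 = n + m) (hmk : m ≤ k) :
    SolvesRepeatedSetAgreement (algorithm D n m b r) n m k :=
  ⟨validity, kAgreement hr hb hmk, obstructionFree hr⟩

end SharedMemory.SetAgreement

theorem theorem5 (D : Type u) (n m k : ℕ) (hm : 1 ≤ m) (hmk : m ≤ k) (hkn : k < n) :
    ∃ A : SharedMemory.AnonymousAlgorithm D ((m + 1) * (n - k) + m ^ 2 + 1),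
      SharedMemory.SolvesRepeatedSetAgreement A n m k := by
  -- With `m = 1 + c` and `n = k + l + 1`, the threshold `b = n - k + m - 1` is `l + 1 + c`; the
  -- registers are `(m + 1) * b + 1` components and the extra one.
  obtain ⟨c, rfl⟩ := Nat.exists_eq_add_of_le hm
  obtain ⟨l, rfl⟩ := Nat.exists_eq_add_of_lt hkn
  have h : (1 + c + 1) * (k + l + 1 - k) + (1 + c) ^ 2 + 1 = (1 + c + 1) * (l + 1 + c) + 1 + 1 := by
    rw [add_assoc k l 1, Nat.add_sub_cancel_left]
    ring
  rw [h]
  exact ⟨_, SharedMemory.SetAgreement.solves (b := l + 1 + c) rfl (by omega) hmk⟩
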